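/- Let $\mathbb{K}\in\{\mathbb{R},\mathbb{C}\}$ and let $H$ be a Hilbert space over $\mathbb{K}$, with bounded operators $\mathcal{L}(H)$ and closed (possibly unbounded) linear operators $\mathcal{C}(H)$. For operators, $A\subseteq B$ means that $B$ extends $A$; sums and products of operators have their natural domains. For a measurable space $(X,\Sigma)$ let $\mathcal{M}(X,\Sigma)$ be the algebra of measurable functions $X\to\mathbb{K}$. A measurable calculus on $(X,\Sigma)$ (with values in $\mathcal{C}(H)$) is a map $\Psi:\mathcal{M}(X,\Sigma)\to\mathcal{C}(H)$ such that for all $f,g\in\mathcal{M}(X,\Sigma)$ and $\lambda\in\mathbb{K}$: (MFC1) $\Psi(\mathbf{1})=\mathrm{I}$; (MFC2) $\Psi(f)+\Psi(g)\subseteq\Psi(f+g)$ and $\lambda\Psi(f)\subseteq\Psi(\lambda f)$; (MFC3) $\Psi(f)\Psi(g)\subseteq\Psi(fg)$ and $\mathrm{dom}(\Psi(f)\Psi(g))=\mathrm{dom}(\Psi(g))\cap\mathrm{dom}(\Psi(fg))$; (MFC4) if $f$ is bounded, then $\Psi(f)\in\mathcal{L}(H)$ and $\Psi(f)^*=\Psi(\overline{f})$;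 (MFC5) if a sequence $f_n\in\mathcal{M}(X,\Sigma)$ is uniformly bounded and converges pointwise to $f$, then $\Psi(f_n)\to\Psi(f)$ weakly. **Theorem.** Let $X$ be a compact Hausdorff space with its Borel $\sigma$-algebra $\mathrm{Bo}(X)$, let $\mathrm{C}(X)$ be the algebra of continuous functions $X\to\mathbb{K}$, and let $\Phi:\mathrm{C}(X)\to\mathcal{L}(H)$ be a unital $*$-homomorphism. Then: (a) There is exactly one measurable calculus $\Psi$ on $(X,\mathrm{Bo}(X))$ with values in $\mathcal{C}(H)$ such that $\Psi(f)=\Phi(f)$ for all $f\in\mathrm{C}(X)$ and such that, for every bounded lower semicontinuous function $f:X\to[0,\infty)$, $$\langle\Psi(f)x,x\rangle=\sup\{\langle\Psi(g)x,x\rangle : g\in\mathrm{C}_{\mathrm{c}}(X),\ 0\le g\le f\}\qquad(x\in H),$$ where $\mathrm{C}_{\mathrm{c}}(X)$ denotes the continuous functions with compact support (here all of $\mathrm{C}(X)$). (b) If $X$ is metrizable, then there is exactly one measurable calculus $\Psi$ on $(X,\mathrm{Bo}(X))$ with values in $\mathcal{C}(H)$ such that $\Psi(f)=\Phi(f)$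 for all $f\in\mathrm{C}(X)$. -/

import Mathlib

open Filter Topology

noncomputable section

/-- The unital `*`-algebra `M(X, Σ)` of measurable functions `X → 𝕜`, with pointwise operations. -/
def MeasFun (𝕜 : Type*) [RCLike 𝕜] (X : Type*) [MeasurableSpace X] :
    StarSubalgebra 𝕜 (X → 𝕜) where
  carrier := {f | Measurable f}
  mul_mem' hf hg := Measurable.mul hf hg
  add_mem' hf hg := Measurable.add hf hg
  algebraMap_mem' _ := measurable_const
  star_mem' hf := RCLike.continuous_conj.measurable.comp hf

namespace MeasFun

/-- A continuous function as a Borel measurable function. -/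
def ofContinuous {𝕜 : Type*} [RCLike 𝕜] {X : Type*} [TopologicalSpace X] [MeasurableSpace X]
    [BorelSpace X] (f : C(X, 𝕜)) : MeasFun 𝕜 X :=
  ⟨fun t => f t, f.continuous.measurable⟩

/-- A real-valued measurable function as a `𝕜`-valued measurable function. -/
def ofRealFun (𝕜 : Type*) [RCLike 𝕜] {X : Type*} [MeasurableSpace X]
    (f : X → ℝ) (hf : Measurable f) : MeasFun 𝕜 X :=
  ⟨fun t => (f t : 𝕜), RCLike.continuous_ofReal.measurable.comp hf⟩

end MeasFun

section Operators

variable {𝕜 : Type*} [RCLike 𝕜] {H : Type*} [NormedAddCommGroup H] [InnerProductSpace 𝕜 H]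

/-- An everywhere defined bounded operator, as a partially defined operator. -/
def ContinuousLinearMap.toTotalPMap (T : H →L[𝕜] H) : H →ₗ.[𝕜] H :=
  (T : H →ₗ[𝕜] H).toPMap ⊤

/-- The natural domain `{x ∈ dom B | B x ∈ dom A}` of the product `A B`. -/
def LinearPMap.prodDomain (A B : H →ₗ.[𝕜] H) : Submodule 𝕜 H :=
  (A.domain.comap B.toFun).map B.domain.subtype

/-- The product `A B` of two partially defined operators, on its natural (maximal) domain. -/
def LinearPMap.prodOp (A B : H →ₗ.[𝕜] H) : H →ₗ.[𝕜] H :=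
  A.comp (B.domRestrict (A.prodDomain B)) (by
    intro x
    obtain ⟨y, hy, hyx⟩ := x.2.1
    have h : B.domRestrict (A.prodDomain B) x = B y := LinearPMap.domRestrict_apply hyx.symm
    rw [h]
    exact hy)

end Operators

/-- A measurable functional calculus `(Φ, H)` on the measurable space `X`: a map from the
measurable functions to the closed operators on `H` with the properties (MFC1)-(MFC5). Here `≤`
on partially defined operators is extension of operators (inclusion of graphs). -/
structure MeasurableCalculus (𝕜 : Type*) [RCLike 𝕜] (X : Type*) [MeasurableSpace X]
    (H : Type*) [NormedAddCommGroup H] [InnerProductSpace 𝕜 H] [CompleteSpace H] where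
  /-- The operator `Φ(f)`. -/
  op : MeasFun 𝕜 X → (H →ₗ.[𝕜] H)
  isClosed_op : ∀ f, (op f).IsClosed
  op_one : op 1 = (ContinuousLinearMap.id 𝕜 H).toTotalPMap
  op_add_le : ∀ f g, op f + op g ≤ op (f + g)
  op_smul_le : ∀ (c : 𝕜) (f), c • op f ≤ op (c • f)
  op_mul_le : ∀ f g, (op f).prodOp (op g) ≤ op (f * g)
  domain_op_mul : ∀ f g, ((op f).prodOp (op g)).domain = (op g).domain ⊓ (op (f * g)).domain
  /-- If `f` is bounded, then `Φ(f)` is a bounded operator with adjoint `Φ(f̄)`. -/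
  op_bounded : ∀ f : MeasFun 𝕜 X, (∃ C : ℝ, ∀ t, ‖f.1 t‖ ≤ C) →
    ∃ T : H →L[𝕜] H, op f = T.toTotalPMap ∧
      op (star f) = (ContinuousLinearMap.adjoint T).toTotalPMap
  /-- If `f n → f` pointwise and boundedly, then `Φ(f n) → Φ(f)` weakly. -/
  op_tendsto : ∀ (f : ℕ → MeasFun 𝕜 X) (f₀ : MeasFun 𝕜 X),
    (∃ C : ℝ, ∀ n t, ‖(f n).1 t‖ ≤ C) →
    (∀ t, Tendsto (fun n => (f n).1 t) atTop (𝓝 (f₀.1 t))) →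
    ∀ (T : ℕ → H →L[𝕜] H) (T₀ : H →L[𝕜] H),
      (∀ n, op (f n) = (T n).toTotalPMap) → op f₀ = T₀.toTotalPMap →
      ∀ x y : H, Tendsto (fun n => inner 𝕜 y (T n x)) atTop (𝓝 (inner 𝕜 y (T₀ x)))

namespace MeasurableCalculus

variable {𝕜 : Type*} [RCLike 𝕜] {X : Type*} [TopologicalSpace X] [MeasurableSpace X]
  [BorelSpace X] {H : Type*} [NormedAddCommGroup H] [InnerProductSpace 𝕜 H] [CompleteSpace H]

/-- The calculus `Ψ` extends the map `Φ`, originally defined on continuous functions. -/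
def Extends (Ψ : MeasurableCalculus 𝕜 X H) (Φ : C(X, 𝕜) → (H →L[𝕜] H)) : Prop :=
  ∀ f : C(X, 𝕜), Ψ.op (MeasFun.ofContinuous f) = (Φ f).toTotalPMap

/-- The regularity condition: for each bounded lower semicontinuous function `f ≥ 0` and each `x`,
`⟨Ψ(f)x, x⟩ = sup {⟨Ψ(g)x, x⟩ | g continuous with compact support, 0 ≤ g ≤ f}`. Mathlib's inner
product is linear in the second variable. -/
def IsRegular (Ψ : MeasurableCalculus 𝕜 X H) : Prop :=
  ∀ (f : X → ℝ) (hf : LowerSemicontinuous f), (∀ t, 0 ≤ f t) → (∃ C : ℝ, ∀ t, f t ≤ C) →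
    ∀ T : H →L[𝕜] H, Ψ.op (MeasFun.ofRealFun 𝕜 f hf.measurable) = T.toTotalPMap →
    ∀ x : H, ∃ s : ℝ, inner 𝕜 x (T x) = (s : 𝕜) ∧
      IsLUB {r : ℝ | ∃ g : C(X, ℝ), HasCompactSupport g ∧ (∀ t, 0 ≤ g t) ∧ (∀ t, g t ≤ f t) ∧
        ∃ S : H →L[𝕜] H,
          Ψ.op (MeasFun.ofRealFun 𝕜 g g.continuous.measurable) = S.toTotalPMap ∧
          inner 𝕜 x (S x) = (r : 𝕜)} s

end MeasurableCalculus

end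

/-! Existence. For each `x`, the positive functional `g ↦ ⟨x, Φ(g)x⟩` is integration against a
finite regular measure `μ_x` (Riesz–Markov–Kakutani). Since `‖Φ(g)x‖² = ∫ |g|² dμ_x`, the orbit map
`g ↦ Φ(g)x` extends to an isometry `L²(μ_x) → H`. The operator of a measurable `f` has domain `{x |
f ∈ L²(μ_x)}` and sends `x` to the image of `f`. Linearity in `x` rests on the parallelogram law for
`x ↦ μ_x` (`specMeasure_add_add_sub`). The product rule, with its exact domain, rests on
`specMeasure_vec`: the measure of `f(Φ)x` has density `|f|²` with respect to `μ_x`. Closedness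
follows by cutting `f` off where `|f| > n` and applying Fatou's lemma.

Uniqueness. The projections of the sets `{|f| ≤ n}` converge strongly to the identity, so a calculus
is determined by its values on bounded functions (`ext_of_bounded`). By bounded limits and a π-λ
argument, it is then determined by the indicators of a generating π-system (`ext_of_generate`). In
the metrizable case, indicators of closed sets are bounded sequential limits of continuous
functions. In general, regularity expresses the quadratic form of the indicator of an open set
through `Φ`. That the constructed calculus is regular comes down to inner regularity of each `μ_x`.
-/

noncomputable section

open MeasureTheory CompactlySupported
open scoped ENNReal NNReal InnerProductSpace

namespace SpectralCalculus

/-! ### Finite regular measures: densities and continuous approximation in `L²` -/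

section Density

variable {X : Type*} [TopologicalSpace X] [CompactSpace X] [T2Space X] [MeasurableSpace X]
  [BorelSpace X]

omit [CompactSpace X] in
/-- A finite measure with a density with respect to a finite regular measure is regular. -/
theorem regular_withDensity (μ : Measure X) [IsFiniteMeasure μ] [μ.Regular] {d : X → ℝ≥0∞}
    (hfin : ∫⁻ t, d t ∂μ ≠ ∞) : (μ.withDensity d).Regular := by
  have : IsFiniteMeasure (μ.withDensity d) := isFiniteMeasure_withDensity hfin
  suffices (μ.withDensity d).InnerRegular from inferInstance
  refine ⟨fun A hA r hr => ?_⟩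
  obtain ⟨ε, hε, hrε⟩ : ∃ ε : ℝ≥0∞, 0 < ε ∧ r + ε < μ.withDensity d A := by
    obtain ⟨s, hrs, hs⟩ := exists_between hr
    exact ⟨s - r, tsub_pos_of_lt hrs, by rwa [add_tsub_cancel_of_le hrs.le]⟩
  -- Absolute continuity of the integral: a set of `μ`-measure below `δ` carries less than `ε` of
  -- the new measure.
  obtain ⟨δ, hδ, h⟩ := exists_pos_setLIntegral_lt_of_measure_lt hfin hε.ne'
  obtain ⟨K, hKA, hK, hμK⟩ := hA.exists_isCompact_sdiff_lt (measure_ne_top μ A) hδ.ne'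
  refine ⟨K, hKA, hK, ?_⟩
  have h1 := h _ hμK
  rw [← withDensity_apply _ (hA.diff hK.measurableSet)] at h1
  have h2 : μ.withDensity d A ≤ μ.withDensity d K + μ.withDensity d (A \ K) := by
    rw [← measure_union Set.disjoint_sdiff_right (hA.diff hK.measurableSet),
      Set.union_sdiff_cancel hKA]
  by_contra! hle
  exact absurd (h2.trans (add_le_add hle h1.le)) (not_le.mpr hrε)

theorem exists_continuous_tendsto_eLpNorm {𝕜 : Type*} [RCLike 𝕜] (μ : Measure X)
    [IsFiniteMeasure μ] [μ.Regular] {f : X → 𝕜} (hf : MemLp f 2 μ) :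
    ∃ g : ℕ → C(X, 𝕜), Tendsto (fun n => eLpNorm (⇑(g n) - f) 2 μ) atTop (𝓝 0) := by
  have h : ∀ n : ℕ, ∃ g : C(X, 𝕜), eLpNorm (⇑g - f) 2 μ ≤ ((n : ℝ≥0∞) + 1)⁻¹ := by
    intro n
    obtain ⟨g, hg, -⟩ := hf.exists_boundedContinuous_eLpNorm_sub_le (by simp)
      (ε := ((n : ℝ≥0∞) + 1)⁻¹) (by simp)
    refine ⟨g.toContinuousMap, ?_⟩
    rw [eLpNorm_sub_comm]
    exact hg
  choose g hg using h
  refine ⟨g, tendsto_of_tendsto_of_tendsto_of_le_of_le tendsto_const_nhds ?_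
    (fun _ => zero_le) hg⟩
  have := (tendsto_add_atTop_iff_nat 1).mpr ENNReal.tendsto_inv_nat_nhds_zero
  simpa using this

end Density

/-! ### Spectral measures and the cyclic isometries -/

variable {𝕜 : Type*} [RCLike 𝕜]
  {X : Type*} [TopologicalSpace X] [CompactSpace X] [T2Space X]
  {H : Type*} [NormedAddCommGroup H] [InnerProductSpace 𝕜 H] [CompleteSpace H]

/-- A real-valued continuous function as a `𝕜`-valued one. -/
def ofRealMap (𝕜 : Type*) [RCLike 𝕜] {X : Type*} [TopologicalSpace X] (f : C(X, ℝ)) : C(X, 𝕜) :=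
  ⟨fun t => (f t : 𝕜), RCLike.continuous_ofReal.comp f.continuous⟩

omit [CompactSpace X] [T2Space X] in
@[simp]
theorem ofRealMap_apply (f : C(X, ℝ)) (t : X) : ofRealMap 𝕜 f t = (f t : 𝕜) := rfl

omit [CompactSpace X] [T2Space X] in
-- The continuous square root serves twice: it gives positivity of the functional, and it turns
-- integrals of nonnegative functions into squared `L²` norms.
theorem ofRealMap_eq_star_mul_self {f : C(X, ℝ)} (hf : ∀ t, 0 ≤ f t) :
    ∃ k : C(X, 𝕜), ofRealMap 𝕜 f = star k * k ∧ ∀ t, ‖k t‖ ^ 2 = f t := by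
  refine ⟨ofRealMap 𝕜 ⟨fun t => √(f t), by fun_prop⟩, ?_, fun t => ?_⟩
  · ext t
    simp [← RCLike.ofReal_mul, Real.mul_self_sqrt (hf t)]
  · simp [Real.sq_sqrt (hf t)]

variable (Φ : C(X, 𝕜) →⋆ₐ[𝕜] (H →L[𝕜] H))

omit [CompactSpace X] [T2Space X] in
theorem inner_star_mul_self (k : C(X, 𝕜)) (x : H) :
    inner 𝕜 x (Φ (star k * k) x) = ((‖Φ k x‖ ^ 2 : ℝ) : 𝕜) := by
  rw [map_mul, map_star, ContinuousLinearMap.star_eq_adjoint, mul_apply_eq_comp,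
    ContinuousLinearMap.adjoint_inner_right, inner_self_eq_norm_sq_to_K]
  simp

/-- The positive functional `f ↦ ⟨Φ(f)x, x⟩` on real continuous functions. -/
def functional (x : H) : C_c(X, ℝ) →ₚ[ℝ] ℝ :=
  PositiveLinearMap.mk₀
    { toFun := fun f => RCLike.re (inner 𝕜 x (Φ (ofRealMap 𝕜 f) x))
      map_add' := fun f g => by
        have : ofRealMap 𝕜 ((f + g : C_c(X, ℝ)) : C(X, ℝ)) = ofRealMap 𝕜 f + ofRealMap 𝕜 g := by
          ext t; simp
        rw [this, map_add, add_apply, inner_add_right, map_add]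
      map_smul' := fun c f => by
        have : ofRealMap 𝕜 ((c • f : C_c(X, ℝ)) : C(X, ℝ)) = (c : 𝕜) • ofRealMap 𝕜 f := by
          ext t; simp
        rw [this, map_smul, smul_apply, inner_smul_right, RCLike.re_ofReal_mul]
        simp }
    (fun f hf => by
      obtain ⟨k, hk, -⟩ := ofRealMap_eq_star_mul_self (𝕜 := 𝕜) (f := (f : C(X, ℝ))) hf
      simp only [LinearMap.coe_mk, AddHom.coe_mk]
      rw [hk, inner_star_mul_self, RCLike.ofReal_re]
      positivity)

variable [MeasurableSpace X] [BorelSpace X]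

/-- The spectral measure of `Φ` at the vector `x`. -/
def specMeasure (x : H) : Measure X := RealRMK.rieszMeasure (functional Φ x)

instance (x : H) : IsFiniteMeasure (specMeasure Φ x) :=
  inferInstanceAs (IsFiniteMeasure (RealRMK.rieszMeasure (functional Φ x)))

instance (x : H) : (specMeasure Φ x).Regular :=
  inferInstanceAs (RealRMK.rieszMeasure (functional Φ x)).Regular

theorem integral_specMeasure (x : H) (f : C(X, ℝ)) :
    ∫ t, f t ∂(specMeasure Φ x) = RCLike.re (inner 𝕜 x (Φ (ofRealMap 𝕜 f) x)) :=
  RealRMK.integral_rieszMeasure (functional Φ x) ⟨f, HasCompactSupport.of_compactSpace _⟩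

theorem integral_norm_sq_specMeasure (x : H) (k : C(X, 𝕜)) :
    ∫ t, ‖k t‖ ^ 2 ∂(specMeasure Φ x) = ‖Φ k x‖ ^ 2 := by
  have h := integral_specMeasure Φ x ⟨fun t => ‖k t‖ ^ 2, by fun_prop⟩
  have h2 : ofRealMap 𝕜 ⟨fun t => ‖k t‖ ^ 2, by fun_prop⟩ = star k * k := by
    ext t; simp [RCLike.conj_mul]
  rw [h2, inner_star_mul_self, RCLike.ofReal_re] at h
  exact h

theorem memLp_continuous (x : H) (g : C(X, 𝕜)) : MemLp g 2 (specMeasure Φ x) := by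
  have h := (ContinuousMap.toLp 2 (specMeasure Φ x) 𝕜 g).2
  rw [Lp.mem_Lp_iff_memLp] at h
  exact (memLp_congr_ae (ContinuousMap.coeFn_toLp _ g)).mp h

theorem eLpNorm_specMeasure (x : H) (k : C(X, 𝕜)) :
    eLpNorm k 2 (specMeasure Φ x) = ‖Φ k x‖ₑ := by
  have hk := memLp_continuous Φ x k
  rw [hk.eLpNorm_eq_integral_rpow_norm (by simp) (by simp), ← ofReal_norm]
  congr 1
  have := integral_norm_sq_specMeasure Φ x k
  simp only [ENNReal.toReal_ofNat, Real.rpow_ofNat]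
  rw [this, ← one_div, ← Real.sqrt_eq_rpow, Real.sqrt_sq (norm_nonneg _)]

/-- The orbit map `g ↦ Φ(g)x`. -/
def orbit (x : H) : C(X, 𝕜) →ₗ[𝕜] H where
  toFun g := Φ g x
  map_add' f g := by simp
  map_smul' c f := by simp

/-- The isometry `L²(μ_x) → H` extending `g ↦ Φ(g)x`. -/
def cyclicMap (x : H) : Lp 𝕜 2 (specMeasure Φ x) →L[𝕜] H :=
  LinearMap.extendOfNorm
    (orbit Φ x)
    (ContinuousMap.toLp (E := 𝕜) 2 (specMeasure Φ x) 𝕜).toLinearMap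

theorem norm_toLp (x : H) (g : C(X, 𝕜)) :
    ‖ContinuousMap.toLp 2 (specMeasure Φ x) 𝕜 g‖ = ‖Φ g x‖ := by
  rw [Lp.norm_def, eLpNorm_congr_ae (ContinuousMap.coeFn_toLp _ g), eLpNorm_specMeasure,
    toReal_enorm]

theorem cyclicMap_toLp (x : H) (g : C(X, 𝕜)) :
    cyclicMap Φ x (ContinuousMap.toLp 2 (specMeasure Φ x) 𝕜 g) = Φ g x := by
  have hd : DenseRange (ContinuousMap.toLp (E := 𝕜) 2 (specMeasure Φ x) 𝕜).toLinearMap :=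
    ContinuousMap.toLp_denseRange 𝕜 _ 𝕜 (by simp)
  have hn : ∃ C : ℝ, ∀ g, ‖orbit Φ x g‖ ≤
      C * ‖(ContinuousMap.toLp (E := 𝕜) 2 (specMeasure Φ x) 𝕜).toLinearMap g‖ :=
    ⟨1, fun g => by rw [one_mul]; exact (norm_toLp Φ x g).ge⟩
  exact LinearMap.extendOfNorm_eq hd hn g

theorem norm_cyclicMap (x : H) (F : Lp 𝕜 2 (specMeasure Φ x)) : ‖cyclicMap Φ x F‖ = ‖F‖ := by
  refine (ContinuousMap.toLp_denseRange 𝕜 (specMeasure Φ x) 𝕜 (p := 2) (by simp)).induction_on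
    (p := fun F => ‖cyclicMap Φ x F‖ = ‖F‖) F ?_ fun g => ?_
  · exact isClosed_eq (by fun_prop) (by fun_prop)
  · rw [cyclicMap_toLp, norm_toLp]

/-- The vector `f(Φ)x`, for `f` square integrable with respect to the spectral measure at `x`. -/
def vec (x : H) {f : X → 𝕜} (hf : MemLp f 2 (specMeasure Φ x)) : H := cyclicMap Φ x (hf.toLp f)

variable {Φ}

theorem enorm_vec {x : H} {f : X → 𝕜} (hf : MemLp f 2 (specMeasure Φ x)) :
    ‖vec Φ x hf‖ₑ = eLpNorm f 2 (specMeasure Φ x) := by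
  rw [← Lp.enorm_toLp hf, ← ofReal_norm, ← ofReal_norm, vec, norm_cyclicMap]

theorem vec_sub {x : H} {f g : X → 𝕜} (hf : MemLp f 2 (specMeasure Φ x))
    (hg : MemLp g 2 (specMeasure Φ x)) : vec Φ x (hf.sub hg) = vec Φ x hf - vec Φ x hg := by
  rw [vec, MemLp.toLp_sub, map_sub, vec, vec]

theorem vec_add {x : H} {f g : X → 𝕜} (hf : MemLp f 2 (specMeasure Φ x))
    (hg : MemLp g 2 (specMeasure Φ x)) : vec Φ x (hf.add hg) = vec Φ x hf + vec Φ x hg := by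
  rw [vec, MemLp.toLp_add, map_add, vec, vec]

theorem vec_const_smul {x : H} {f : X → 𝕜} (hf : MemLp f 2 (specMeasure Φ x)) (c : 𝕜) :
    vec Φ x (hf.const_smul c) = c • vec Φ x hf := by
  rw [vec, MemLp.toLp_const_smul, map_smul, vec]

theorem vec_continuous {x : H} {g : C(X, 𝕜)} (hg : MemLp g 2 (specMeasure Φ x)) :
    vec Φ x hg = Φ g x := by
  rw [vec, ← cyclicMap_toLp]
  congr 1


theorem tendsto_vec {ι : Type*} {l : Filter ι} {x : H} {f : X → 𝕜} {g : ι → X → 𝕜}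
    (hf : MemLp f 2 (specMeasure Φ x)) (hg : ∀ n, MemLp (g n) 2 (specMeasure Φ x))
    (h : Tendsto (fun n => eLpNorm (g n - f) 2 (specMeasure Φ x)) l (𝓝 0)) :
    Tendsto (fun n => vec Φ x (hg n)) l (𝓝 (vec Φ x hf)) := by
  rw [tendsto_iff_edist_tendsto_0]
  refine h.congr fun n => ?_
  rw [edist_eq_enorm_sub, ← vec_sub, enorm_vec]

theorem tendsto_vec_continuous {ι : Type*} {l : Filter ι} {x : H} {f : X → 𝕜} {g : ι → C(X, 𝕜)}
    (hf : MemLp f 2 (specMeasure Φ x))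
    (h : Tendsto (fun n => eLpNorm (⇑(g n) - f) 2 (specMeasure Φ x)) l (𝓝 0)) :
    Tendsto (fun n => Φ (g n) x) l (𝓝 (vec Φ x hf)) :=
  (tendsto_vec hf (fun n => memLp_continuous Φ x (g n)) h).congr fun _ => vec_continuous _

end SpectralCalculus

/-! ### Dependence of `μ_x` and `f(Φ)x` on the vector and on the function -/

namespace SpectralCalculus

variable {𝕜 : Type*} [RCLike 𝕜]
  {X : Type*} [TopologicalSpace X] [CompactSpace X] [T2Space X] [MeasurableSpace X] [BorelSpace X]
  {H : Type*} [NormedAddCommGroup H] [InnerProductSpace 𝕜 H] [CompleteSpace H]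
  {Φ : C(X, 𝕜) →⋆ₐ[𝕜] (H →L[𝕜] H)}

omit [TopologicalSpace X] [CompactSpace X] [T2Space X] [BorelSpace X] in
theorem memLp_two_add_measure {μ ν : Measure X} {f : X → 𝕜} (hμ : MemLp f 2 μ)
    (hν : MemLp f 2 ν) : MemLp f 2 (μ + ν) := by
  refine ⟨hμ.1.add_measure hν.1, ?_⟩
  rw [eLpNorm_lt_top_iff_lintegral_rpow_enorm_lt_top (by simp) (by simp), lintegral_add_measure]
  exact ENNReal.add_lt_top.mpr
    ⟨(eLpNorm_lt_top_iff_lintegral_rpow_enorm_lt_top (by simp) (by simp)).mp hμ.2,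
      (eLpNorm_lt_top_iff_lintegral_rpow_enorm_lt_top (by simp) (by simp)).mp hν.2⟩

omit [TopologicalSpace X] [CompactSpace X] [T2Space X] [BorelSpace X] in
theorem tendsto_eLpNorm_of_measure_le_smul {ι : Type*} {l : Filter ι} {μ ν : Measure X} {c : ℝ≥0∞}
    (hc : c ≠ ∞) (h : ν ≤ c • μ) {F : ι → X → 𝕜}
    (hF : Tendsto (fun n => eLpNorm (F n) 2 μ) l (𝓝 0)) :
    Tendsto (fun n => eLpNorm (F n) 2 ν) l (𝓝 0) := by
  have h1 : Tendsto (fun n => c ^ (1 / (2 : ℝ≥0∞)).toReal * eLpNorm (F n) 2 μ) l (𝓝 0) := by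
    simpa using ENNReal.Tendsto.const_mul (a := c ^ (1 / (2 : ℝ≥0∞)).toReal) hF
      (Or.inr (by simp [hc]))
  refine tendsto_of_tendsto_of_tendsto_of_le_of_le tendsto_const_nhds h1 (fun _ => zero_le)
    fun n => (eLpNorm_mono_measure _ h).trans ?_
  rw [eLpNorm_smul_measure_of_ne_top (by simp), smul_eq_mul]

/-- Tested on a continuous function, this is the parallelogram identity of a quadratic form;
regularity makes such tests sufficient. It yields the domination of `μ_{x+y}` that makes the domains
subspaces. -/
theorem specMeasure_add_add_sub (x y : H) :
    specMeasure Φ (x + y) + specMeasure Φ (x - y) =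
      (2 : ℝ≥0) • (specMeasure Φ x + specMeasure Φ y) := by
  refine Measure.ext_of_integral_eq_on_compactlySupported fun f => ?_
  have key : ∀ z : H, ∫ t, f t ∂(specMeasure Φ z) = _ := fun z => integral_specMeasure Φ z f
  rw [integral_add_measure f.integrable f.integrable, integral_smul_nnreal_measure,
    integral_add_measure f.integrable f.integrable, key, key, key, key]
  simp only [map_add, map_sub, inner_add_left, inner_add_right, inner_sub_left, inner_sub_right,
    NNReal.smul_def, smul_eq_mul, NNReal.coe_ofNat]
  ring

theorem specMeasure_smul (c : 𝕜) (x : H) :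
    specMeasure Φ (c • x) = (‖c‖₊ ^ 2) • specMeasure Φ x := by
  refine Measure.ext_of_integral_eq_on_compactlySupported fun f => ?_
  have key : ∀ z : H, ∫ t, f t ∂(specMeasure Φ z) = _ := fun z => integral_specMeasure Φ z f
  rw [integral_smul_nnreal_measure, key, key, map_smul, inner_smul_left, inner_smul_right,
    ← mul_assoc, RCLike.conj_mul, NNReal.smul_def, smul_eq_mul]
  rw [← RCLike.ofReal_pow, RCLike.re_ofReal_mul]
  simp

theorem specMeasure_add_le (x y : H) :
    specMeasure Φ (x + y) ≤ (2 : ℝ≥0∞) • (specMeasure Φ x + specMeasure Φ y) := by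
  have : (2 : ℝ≥0∞) • (specMeasure Φ x + specMeasure Φ y) =
      (2 : ℝ≥0) • (specMeasure Φ x + specMeasure Φ y) := rfl
  rw [this, ← specMeasure_add_add_sub]
  exact Measure.le_add_right le_rfl

/-- One sequence of continuous functions approximating `f` in `L²(μ_x + μ_y)` also does so in
`L²(μ_{x+y})` by domination; additivity of each `Φ(g n)` passes to the limit. -/
theorem exists_vec_add {x y : H} {f : X → 𝕜} (hx : MemLp f 2 (specMeasure Φ x))
    (hy : MemLp f 2 (specMeasure Φ y)) :
    ∃ h : MemLp f 2 (specMeasure Φ (x + y)), vec Φ (x + y) h = vec Φ x hx + vec Φ y hy := by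
  have hf := memLp_two_add_measure hx hy
  obtain ⟨g, hg⟩ := exists_continuous_tendsto_eLpNorm _ hf
  have h := hf.of_measure_le_smul (by simp) (specMeasure_add_le x y)
  refine ⟨h, tendsto_nhds_unique (tendsto_vec_continuous h
    (tendsto_eLpNorm_of_measure_le_smul (by simp) (specMeasure_add_le x y) hg)) ?_⟩
  simp only [map_add]
  refine (tendsto_vec_continuous hx ?_).add (tendsto_vec_continuous hy ?_)
  · exact tendsto_eLpNorm_of_measure_le_smul (c := 1) (by simp)
      (by rw [one_smul]; exact Measure.le_add_right le_rfl) hg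
  · exact tendsto_eLpNorm_of_measure_le_smul (c := 1) (by simp)
      (by rw [one_smul]; exact Measure.le_add_left le_rfl) hg

theorem exists_vec_smul {x : H} {f : X → 𝕜} (c : 𝕜) (hx : MemLp f 2 (specMeasure Φ x)) :
    ∃ h : MemLp f 2 (specMeasure Φ (c • x)), vec Φ (c • x) h = c • vec Φ x hx := by
  have hle : specMeasure Φ (c • x) ≤ ((‖c‖₊ ^ 2 : ℝ≥0) : ℝ≥0∞) • specMeasure Φ x := by
    rw [specMeasure_smul]; rfl
  obtain ⟨g, hg⟩ := exists_continuous_tendsto_eLpNorm _ hx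
  have h := hx.of_measure_le_smul (by simp) hle
  refine ⟨h, tendsto_nhds_unique (tendsto_vec_continuous h
    (tendsto_eLpNorm_of_measure_le_smul (by simp) hle hg)) ?_⟩
  simp only [map_smul]
  exact (tendsto_vec_continuous hx hg).const_smul c

theorem exists_vec_zero (f : X → 𝕜) (hf : Measurable f) :
    ∃ h : MemLp f 2 (specMeasure Φ 0), vec Φ 0 h = 0 := by
  have h0 : specMeasure Φ 0 = 0 := by
    have := specMeasure_smul (Φ := Φ) 0 0
    simpa using this
  have h : MemLp f 2 (specMeasure Φ 0) := ⟨hf.aestronglyMeasurable, by rw [h0]; simp⟩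
  refine ⟨h, ?_⟩
  rw [← enorm_eq_zero, enorm_vec, h0, eLpNorm_measure_zero]

omit [T2Space X] [BorelSpace X] in
theorem tendsto_eLpNorm_continuous_mul {ι : Type*} {l : Filter ι} {μ : Measure X} (k : C(X, 𝕜))
    {F : ι → X → 𝕜} (hF : Tendsto (fun n => eLpNorm (F n) 2 μ) l (𝓝 0)) :
    Tendsto (fun n => eLpNorm (⇑k * F n) 2 μ) l (𝓝 0) := by
  have h1 : Tendsto (fun n => (‖k‖₊ : ℝ≥0∞) * eLpNorm (F n) 2 μ) l (𝓝 0) := by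
    simpa using ENNReal.Tendsto.const_mul (a := (‖k‖₊ : ℝ≥0∞)) hF (Or.inr (by simp))
  refine tendsto_of_tendsto_of_tendsto_of_le_of_le tendsto_const_nhds h1 (fun _ => zero_le)
    fun n => eLpNorm_le_nnreal_smul_eLpNorm_of_ae_le_mul (.of_forall fun t => ?_) 2
  rw [Pi.mul_apply, nnnorm_mul]
  gcongr
  exact k.norm_coe_le_norm t

theorem exists_vec_continuous_mul {x : H} {f : X → 𝕜} (k : C(X, 𝕜))
    (hx : MemLp f 2 (specMeasure Φ x)) :
    ∃ h : MemLp (⇑k * f) 2 (specMeasure Φ x), vec Φ x h = Φ k (vec Φ x hx) := by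
  have h : MemLp (⇑k * f) 2 (specMeasure Φ x) :=
    MemLp.of_le_mul (c := ‖k‖) hx (k.continuous.aestronglyMeasurable.mul hx.1)
      (.of_forall fun t => by
        rw [Pi.mul_apply, norm_mul]; gcongr; exact k.norm_coe_le_norm t)
  obtain ⟨g, hg⟩ := exists_continuous_tendsto_eLpNorm _ hx
  refine ⟨h, tendsto_nhds_unique (tendsto_vec_continuous (g := fun n => k * g n) h ?_)
    (((Φ k).continuous.tendsto _).comp (tendsto_vec_continuous hx hg) |>.congr fun n => ?_)⟩
  · refine (tendsto_eLpNorm_continuous_mul k hg).congr fun n => ?_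
    rw [mul_sub, ContinuousMap.coe_mul]
  · simp

omit [TopologicalSpace X] [CompactSpace X] [T2Space X] [BorelSpace X] in
theorem eLpNorm_two_sq (μ : Measure X) (f : X → 𝕜) :
    eLpNorm f 2 μ ^ 2 = ∫⁻ t, ‖f t‖ₑ ^ 2 ∂μ := by
  simpa using eLpNorm_nnreal_pow_eq_lintegral (μ := μ) (f := f) (p := 2) (by simp)

omit [TopologicalSpace X] [CompactSpace X] [T2Space X] [BorelSpace X] in
theorem eLpNorm_two_withDensity (μ : Measure X) {f g : X → 𝕜} (hf : Measurable f)
    (hg : Measurable g) :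
    eLpNorm g 2 (μ.withDensity fun t => ‖f t‖ₑ ^ 2) = eLpNorm (g * f) 2 μ := by
  rw [← (ENNReal.pow_right_strictMono (n := 2) (by simp)).injective.eq_iff, eLpNorm_two_sq, eLpNorm_two_sq,
    lintegral_withDensity_eq_lintegral_mul _ (by fun_prop) (by fun_prop)]
  refine lintegral_congr fun t => ?_
  simp [mul_pow, mul_comm]

/-- For continuous `k`, `∫ |k|² dμ_{f(Φ)x} = ‖Φ(k) f(Φ)x‖² = ‖(kf)(Φ)x‖² = ∫ |k|²|f|² dμ_x`. Every
nonnegative continuous function has the form `|k|²`, and both measures are regular, so these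
integrals identify them. -/
theorem specMeasure_vec {x : H} {f : X → 𝕜} (hf : Measurable f)
    (hx : MemLp f 2 (specMeasure Φ x)) :
    specMeasure Φ (vec Φ x hx) = (specMeasure Φ x).withDensity fun t => ‖f t‖ₑ ^ 2 := by
  have hfin : ∫⁻ t, ‖f t‖ₑ ^ 2 ∂(specMeasure Φ x) ≠ ∞ := by
    rw [← eLpNorm_two_sq]; exact ENNReal.pow_ne_top hx.2.ne
  have := regular_withDensity (specMeasure Φ x) hfin
  refine Measure.ext_of_integral_eq_on_compactlySupported_nnreal fun u => ?_
  obtain ⟨k, -, hk⟩ := ofRealMap_eq_star_mul_self (𝕜 := 𝕜)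
    (f := ⟨fun t => (u t : ℝ), by fun_prop⟩) (fun t => (u t).2)
  have hu : ∀ t, (‖k t‖ₑ ^ 2 : ℝ≥0∞) = u t := fun t => by
    rw [← ofReal_norm, ← ENNReal.ofReal_pow (norm_nonneg _), hk t]
    simp
  have hint : ∀ ν : Measure X, ∫ t, (u t : ℝ) ∂ν = (eLpNorm k 2 ν ^ 2).toReal := fun ν => by
    rw [eLpNorm_two_sq, integral_eq_lintegral_of_nonneg_ae (f := fun t => (u t : ℝ))
      (.of_forall fun t => (u t).2) (by fun_prop)]
    simp [hu]
  obtain ⟨h, hk⟩ := exists_vec_continuous_mul k hx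
  rw [hint, hint, eLpNorm_specMeasure, ← hk, enorm_vec,
    eLpNorm_two_withDensity _ hf k.continuous.measurable]

theorem memLp_vec_iff {x : H} {f g : X → 𝕜} (hf : Measurable f) (hg : Measurable g)
    (hx : MemLp f 2 (specMeasure Φ x)) :
    MemLp g 2 (specMeasure Φ (vec Φ x hx)) ↔ MemLp (g * f) 2 (specMeasure Φ x) := by
  rw [MemLp, MemLp, specMeasure_vec hf, eLpNorm_two_withDensity _ hf hg]
  exact and_congr (iff_of_true hg.aestronglyMeasurable (hg.mul hf).aestronglyMeasurable) Iff.rfl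

/-- By the density formula, approximating `g` in `L²(μ_{f(Φ)x})` by continuous `k n` is the same as
approximating `g * f` by `k n * f` in `L²(μ_x)`. -/
theorem vec_vec {x : H} {f g : X → 𝕜} (hf : Measurable f) (hg : Measurable g)
    (hx : MemLp f 2 (specMeasure Φ x)) (hy : MemLp g 2 (specMeasure Φ (vec Φ x hx)))
    (hgf : MemLp (g * f) 2 (specMeasure Φ x)) :
    vec Φ (vec Φ x hx) hy = vec Φ x hgf := by
  obtain ⟨k, hk⟩ := exists_continuous_tendsto_eLpNorm _ hy
  refine tendsto_nhds_unique (tendsto_vec_continuous hy hk) ?_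
  choose h1 h2 using fun n => exists_vec_continuous_mul (Φ := Φ) (k n) hx
  simp only [← h2]
  refine tendsto_vec hgf h1 (hk.congr fun n => ?_)
  rw [specMeasure_vec hf, eLpNorm_two_withDensity _ hf ((k n).continuous.measurable.sub hg),
    sub_mul]

/-- A common approximating sequence for `μ_x` and `μ_y` reduces this to `Φ` being a
`*`-homomorphism. -/
theorem inner_vec_star {x y : H} {f : X → 𝕜} (hx : MemLp f 2 (specMeasure Φ x))
    (hy : MemLp f 2 (specMeasure Φ y)) (hy' : MemLp (star f) 2 (specMeasure Φ y)) :
    inner 𝕜 y (vec Φ x hx) = inner 𝕜 (vec Φ y hy') x := by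
  obtain ⟨g, hg⟩ := exists_continuous_tendsto_eLpNorm _ (memLp_two_add_measure hx hy)
  have hgx := tendsto_eLpNorm_of_measure_le_smul (c := 1) (by simp)
      (by rw [one_smul]; exact Measure.le_add_right le_rfl) hg (ν := specMeasure Φ x)
  have hgy := tendsto_eLpNorm_of_measure_le_smul (c := 1) (by simp)
      (by rw [one_smul]; exact Measure.le_add_left le_rfl) hg (ν := specMeasure Φ y)
  have h1 := (tendsto_const_nhds (x := y)).inner (𝕜 := 𝕜) (tendsto_vec_continuous hx hgx)
  have hgy' : Tendsto (fun n => eLpNorm (⇑(star (g n)) - star f) 2 (specMeasure Φ y)) atTop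
      (𝓝 0) := hgy.congr fun n => by
    refine eLpNorm_congr_norm_ae (.of_forall fun t => ?_)
    simp [← map_sub]
  have h2 := (tendsto_vec_continuous hy' hgy').inner (𝕜 := 𝕜) (tendsto_const_nhds (x := x))
  refine tendsto_nhds_unique h1 (h2.congr fun n => ?_)
  rw [map_star, ContinuousLinearMap.star_eq_adjoint, ContinuousLinearMap.adjoint_inner_left]

end SpectralCalculus

/-! ### Graphs of sums, multiples and products of partial operators -/

section Graphs

variable {𝕜 : Type*} [RCLike 𝕜] {H : Type*} [NormedAddCommGroup H] [InnerProductSpace 𝕜 H]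

theorem ContinuousLinearMap.mem_graph_toTotalPMap {T : H →L[𝕜] H} {x y : H} :
    (x, y) ∈ T.toTotalPMap.graph ↔ T x = y := by
  simp [LinearPMap.mem_graph_iff, ContinuousLinearMap.toTotalPMap]

theorem ContinuousLinearMap.toTotalPMap_injective :
    Function.Injective (ContinuousLinearMap.toTotalPMap : (H →L[𝕜] H) → _) := by
  intro S T h
  ext x
  rw [← ContinuousLinearMap.mem_graph_toTotalPMap, h, ContinuousLinearMap.mem_graph_toTotalPMap]

theorem LinearPMap.ext_graph {A B : H →ₗ.[𝕜] H}
    (h : ∀ x y, (x, y) ∈ A.graph ↔ (x, y) ∈ B.graph) : A = B :=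
  LinearPMap.eq_of_eq_graph (by ext ⟨x, y⟩; exact h x y)

theorem LinearPMap.le_of_graph {A B : H →ₗ.[𝕜] H}
    (h : ∀ x y, (x, y) ∈ A.graph → (x, y) ∈ B.graph) : A ≤ B :=
  LinearPMap.le_of_le_graph fun p hp => h p.1 p.2 hp

theorem LinearPMap.mem_graph_add {A B : H →ₗ.[𝕜] H} {x z : H} :
    (x, z) ∈ (A + B).graph ↔ ∃ a b, (x, a) ∈ A.graph ∧ (x, b) ∈ B.graph ∧ a + b = z := by
  simp only [LinearPMap.mem_graph_iff]
  constructor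
  · rintro ⟨y, rfl, rfl⟩
    exact ⟨_, _, ⟨⟨y, y.2.1⟩, rfl, rfl⟩, ⟨⟨y, y.2.2⟩, rfl, rfl⟩, rfl⟩
  · rintro ⟨a, b, ⟨u, rfl, rfl⟩, ⟨v, hv, rfl⟩, rfl⟩
    refine ⟨⟨u, u.2, hv ▸ v.2⟩, rfl, ?_⟩
    rw [LinearPMap.add_apply]
    congr 2
    exact Subtype.ext hv.symm

theorem LinearPMap.mem_graph_smul {A : H →ₗ.[𝕜] H} {c : 𝕜} {x z : H} :
    (x, z) ∈ (c • A).graph ↔ ∃ a, (x, a) ∈ A.graph ∧ c • a = z := by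
  simp only [LinearPMap.mem_graph_iff]
  constructor
  · rintro ⟨y, rfl, rfl⟩
    exact ⟨_, ⟨y, rfl, rfl⟩, rfl⟩
  · rintro ⟨_, ⟨y, rfl, rfl⟩, rfl⟩
    exact ⟨y, rfl, rfl⟩

theorem LinearPMap.mem_graph_prodOp {A B : H →ₗ.[𝕜] H} {x z : H} :
    (x, z) ∈ (A.prodOp B).graph ↔ ∃ y, (x, y) ∈ B.graph ∧ (y, z) ∈ A.graph := by
  simp only [LinearPMap.mem_graph_iff]
  constructor
  · rintro ⟨⟨x, h1, h2⟩, rfl, rfl⟩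
    refine ⟨_, ⟨⟨x, h2⟩, rfl, rfl⟩, ⟨_, ?_⟩, rfl, rfl⟩
    obtain ⟨x', hx', rfl⟩ := h1
    exact hx'
  · rintro ⟨_, ⟨x, rfl, rfl⟩, ⟨y, hy, rfl⟩⟩
    refine ⟨⟨x, ⟨x, ?_, rfl⟩, x.2⟩, rfl, ?_⟩
    · change B x ∈ A.domain
      rw [← hy]; exact y.2
    · change A _ = A _
      congr 1
      exact Subtype.ext hy.symm

end Graphs

/-! ### Indicators and cutoffs -/

namespace MeasFun

variable {𝕜 : Type*} [RCLike 𝕜] {X : Type*} [MeasurableSpace X]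

/-- The indicator of a measurable set. -/
def indicator (𝕜 : Type*) [RCLike 𝕜] {X : Type*} [MeasurableSpace X] (A : Set X)
    (hA : MeasurableSet A) : MeasFun 𝕜 X :=
  ⟨A.indicator 1, measurable_one.indicator hA⟩

theorem norm_indicator_le (A : Set X) (hA : MeasurableSet A) (t : X) :
    ‖(indicator 𝕜 A hA).1 t‖ ≤ 1 := by
  by_cases h : t ∈ A <;> simp [indicator, h]

/-- The indicator of the set where `‖f‖ ≤ n`. -/
def cutoff (f : MeasFun 𝕜 X) (n : ℕ) : MeasFun 𝕜 X :=
  indicator 𝕜 {t | ‖f.1 t‖ ≤ n} (f.2.norm measurableSet_Iic)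

theorem norm_cutoff_le (f : MeasFun 𝕜 X) (n : ℕ) (t : X) : ‖(cutoff f n).1 t‖ ≤ 1 :=
  norm_indicator_le _ _ t

theorem norm_cutoff_mul_le (f : MeasFun 𝕜 X) (n : ℕ) (t : X) :
    ‖(cutoff f n * f).1 t‖ ≤ n := by
  by_cases h : ‖f.1 t‖ ≤ n <;> simp [cutoff, indicator, h]

theorem norm_cutoff_mul_le_norm (f : MeasFun 𝕜 X) (n : ℕ) (t : X) :
    ‖(cutoff f n * f).1 t‖ ≤ ‖f.1 t‖ := by
  by_cases h : ‖f.1 t‖ ≤ n <;> simp [cutoff, indicator, h]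

theorem tendsto_cutoff (f : MeasFun 𝕜 X) (t : X) :
    Tendsto (fun n => (cutoff f n).1 t) atTop (𝓝 1) := by
  refine tendsto_const_nhds.congr' ?_
  filter_upwards [eventually_ge_atTop ⌈‖f.1 t‖⌉₊] with n hn
  have : ‖f.1 t‖ ≤ n := (Nat.le_ceil _).trans (by exact_mod_cast hn)
  simp [cutoff, indicator, this]

end MeasFun

/-! ### The operators `f(Φ)` and the axioms of a measurable calculus -/

namespace SpectralCalculus

variable {𝕜 : Type*} [RCLike 𝕜]
  {X : Type*} [TopologicalSpace X] [CompactSpace X] [T2Space X] [MeasurableSpace X] [BorelSpace X]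
  {H : Type*} [NormedAddCommGroup H] [InnerProductSpace 𝕜 H] [CompleteSpace H]
  (Φ : C(X, 𝕜) →⋆ₐ[𝕜] (H →L[𝕜] H))

omit [TopologicalSpace X] [CompactSpace X] [T2Space X] [BorelSpace X] in
theorem tendsto_eLpNorm_of_dominated {μ : Measure X} {F : ℕ → X → 𝕜} {f : X → 𝕜} {b : X → ℝ}
    (hF : ∀ n, Measurable (F n)) (hf : Measurable f) (hb : MemLp b 2 μ)
    (hle : ∀ n t, ‖F n t‖ ≤ b t) (hlim : ∀ t, Tendsto (fun n => F n t) atTop (𝓝 (f t))) :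
    Tendsto (fun n => eLpNorm (F n - f) 2 μ) atTop (𝓝 0) := by
  have hfle : ∀ t, ‖f t‖ ≤ b t := fun t =>
    le_of_tendsto (hlim t).norm (.of_forall fun n => hle n t)
  have h1 : Tendsto (fun n => ∫⁻ t, ‖(F n - f) t‖ₑ ^ 2 ∂μ) atTop (𝓝 (∫⁻ _, 0 ∂μ)) := by
    -- Both `F n` and the limit are bounded by `b`, so their difference is bounded by `2 * b`.
    refine tendsto_lintegral_of_dominated_convergence (fun t => ‖(2 * b t : ℝ)‖ₑ ^ 2)
      (fun n => by have := (hF n).sub hf; fun_prop) (fun n => .of_forall fun t => ?_) ?_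
      (.of_forall fun t => ?_)
    · dsimp only
      gcongr
      rw [← ofReal_norm, ← ofReal_norm]
      refine ENNReal.ofReal_le_ofReal ((norm_sub_le _ _).trans ?_)
      rw [Real.norm_eq_abs]
      exact ((add_le_add (hle n t) (hfle t)).trans_eq (two_mul _).symm).trans (le_abs_self _)
    · have := eLpNorm_two_sq μ (fun t => 2 * b t)
      rw [← this]
      exact ENNReal.pow_ne_top (hb.const_mul 2).2.ne
    · have h2 : Tendsto (fun n => ‖F n t - f t‖ₑ) atTop (𝓝 0) := by
        simpa [edist_eq_enorm_sub] using tendsto_iff_edist_tendsto_0.mp (hlim t)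
      simpa [Function.comp_def] using (ENNReal.continuous_pow 2).tendsto 0 |>.comp h2
  simp only [← eLpNorm_two_sq, lintegral_zero] at h1
  have h2 := h1.ennrpow_const (2 : ℝ)⁻¹
  rw [ENNReal.zero_rpow_of_pos (by norm_num)] at h2
  refine h2.congr fun n => ?_
  rw [← ENNReal.rpow_two, ENNReal.rpow_rpow_inv (by simp)]

theorem eLpNorm_one_specMeasure (x : H) :
    eLpNorm (1 : X → 𝕜) 2 (specMeasure Φ x) = ‖x‖ₑ := by
  have := eLpNorm_specMeasure Φ x 1
  simpa using this

theorem eLpNorm_le_of_bound (x : H) {f : X → 𝕜} {C : ℝ≥0} (hC : ∀ t, ‖f t‖ ≤ C) :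
    eLpNorm f 2 (specMeasure Φ x) ≤ C * ‖x‖ₑ := by
  rw [← eLpNorm_one_specMeasure Φ x]
  exact eLpNorm_le_nnreal_smul_eLpNorm_of_ae_le_mul (.of_forall fun t => by simpa [← NNReal.coe_le_coe] using hC t) 2

theorem memLp_of_bound (x : H) {f : X → 𝕜} (hf : Measurable f) {C : ℝ} (hC : ∀ t, ‖f t‖ ≤ C) :
    MemLp f 2 (specMeasure Φ x) :=
  MemLp.of_bound hf.aestronglyMeasurable C (.of_forall hC)

/-- The operator `f(Φ)`, with domain the vectors whose spectral measure makes `f` square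
integrable. -/
def op (f : MeasFun 𝕜 X) : H →ₗ.[𝕜] H where
  domain :=
    { carrier := {x | MemLp f.1 2 (specMeasure Φ x)}
      add_mem' := fun hx hy => (exists_vec_add hx hy).1
      zero_mem' := (exists_vec_zero f.1 f.2).1
      smul_mem' := fun c _ hx => (exists_vec_smul c hx).1 }
  toFun :=
    { toFun := fun x => vec Φ x x.2
      map_add' := fun x y => (exists_vec_add x.2 y.2).2
      map_smul' := fun c x => (exists_vec_smul c x.2).2 }

variable {Φ}

theorem mem_graph_op {f : MeasFun 𝕜 X} {x y : H} :
    (x, y) ∈ (op Φ f).graph ↔ ∃ h : MemLp f.1 2 (specMeasure Φ x), vec Φ x h = y := by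
  rw [LinearPMap.mem_graph_iff]
  constructor
  · rintro ⟨⟨x, h⟩, rfl, rfl⟩
    exact ⟨h, rfl⟩
  · rintro ⟨h, rfl⟩
    exact ⟨⟨x, h⟩, rfl, rfl⟩

variable (Φ)

theorem exists_op_eq {f : MeasFun 𝕜 X} {C : ℝ≥0} (hC : ∀ t, ‖f.1 t‖ ≤ C) :
    ∃ T : H →L[𝕜] H, op Φ f = T.toTotalPMap ∧ ∀ x, ‖T x‖ ≤ C * ‖x‖ := by
  have hmem : ∀ x : H, MemLp f.1 2 (specMeasure Φ x) := fun x => memLp_of_bound Φ x f.2 hC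
  have hbd : ∀ x : H, ‖vec Φ x (hmem x)‖ ≤ C * ‖x‖ := fun x => by
    have h := eLpNorm_le_of_bound Φ x hC
    rw [← enorm_vec (hmem x)] at h
    simp only [enorm_eq_nnnorm] at h
    exact_mod_cast h
  refine ⟨LinearMap.mkContinuous
    { toFun := fun x => vec Φ x (hmem x)
      map_add' := fun x y => (exists_vec_add (hmem x) (hmem y)).2
      map_smul' := fun c x => (exists_vec_smul c (hmem x)).2 } C hbd,
    LinearPMap.ext_graph fun x y => ?_, hbd⟩
  rw [mem_graph_op, ContinuousLinearMap.mem_graph_toTotalPMap]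
  exact ⟨fun ⟨_, h⟩ => h, fun h => ⟨hmem x, h⟩⟩

variable {Φ}

theorem vec_eq_of_op_eq {f : MeasFun 𝕜 X} {T : H →L[𝕜] H} (h : op Φ f = T.toTotalPMap) (x : H) :
    ∃ hx : MemLp f.1 2 (specMeasure Φ x), vec Φ x hx = T x := by
  rw [← mem_graph_op, h, ContinuousLinearMap.mem_graph_toTotalPMap]

/-- The equivalence encodes both halves of (MFC3): one direction is the inclusion of products, the
other the formula for the domain. -/
theorem mem_graph_op_vec {f g : MeasFun 𝕜 X} {x y z : H} (hxy : (x, y) ∈ (op Φ g).graph) :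
    (y, z) ∈ (op Φ f).graph ↔ (x, z) ∈ (op Φ (f * g)).graph := by
  obtain ⟨hx, rfl⟩ := mem_graph_op.mp hxy
  rw [mem_graph_op, mem_graph_op]
  constructor
  · rintro ⟨hy, rfl⟩
    exact ⟨(memLp_vec_iff g.2 f.2 hx).mp hy, (vec_vec g.2 f.2 hx hy _).symm⟩
  · rintro ⟨hy, rfl⟩
    exact ⟨(memLp_vec_iff g.2 f.2 hx).mpr hy, vec_vec g.2 f.2 hx _ hy⟩

theorem tendsto_of_op_eq {F : ℕ → MeasFun 𝕜 X} {f : MeasFun 𝕜 X} {C : ℝ}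
    (hC : ∀ n t, ‖(F n).1 t‖ ≤ C) (hlim : ∀ t, Tendsto (fun n => (F n).1 t) atTop (𝓝 (f.1 t)))
    {T : ℕ → H →L[𝕜] H} {T₀ : H →L[𝕜] H} (hT : ∀ n, op Φ (F n) = (T n).toTotalPMap)
    (hT₀ : op Φ f = T₀.toTotalPMap) (x : H) : Tendsto (fun n => T n x) atTop (𝓝 (T₀ x)) := by
  choose h1 h2 using fun n => vec_eq_of_op_eq (hT n) x
  obtain ⟨h3, h4⟩ := vec_eq_of_op_eq hT₀ x
  simp only [← h2, ← h4]
  exact tendsto_vec h3 h1 (tendsto_eLpNorm_of_dominated (b := fun _ => C) (fun n => (F n).2) f.2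
    (memLp_const C) hC hlim)

/-- With `S k`, `T k` the bounded operators of the cutoff and of the cut-off `f`, `T k` equals `S k`
after `f(Φ)` on the domain. In the limit along the graph, `T k x = S k y`. Fatou then puts `x` in
the domain, and `k → ∞` gives `f(Φ)x = y`. -/
theorem isClosed_op (f : MeasFun 𝕜 X) : (op Φ f).IsClosed := by
  refine IsSeqClosed.isClosed fun p q hp hpq => ?_
  obtain ⟨x, y⟩ := q
  have hx : Tendsto (fun n => (p n).1) atTop (𝓝 x) := (continuous_fst.tendsto _).comp hpq
  have hy : Tendsto (fun n => (p n).2) atTop (𝓝 y) := (continuous_snd.tendsto _).comp hpq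
  choose T hT using fun k : ℕ => (exists_op_eq Φ (f := MeasFun.cutoff f k * f) (C := k)
    (fun t => by simpa using MeasFun.norm_cutoff_mul_le f k t)).imp fun _ h => h.1
  choose S hS hS1 using fun k : ℕ => exists_op_eq Φ (f := MeasFun.cutoff f k) (C := 1)
    (fun t => by simpa using MeasFun.norm_cutoff_le f k t)
  have hTS : ∀ k, T k x = S k y := fun k => by
    refine tendsto_nhds_unique (((T k).continuous.tendsto x).comp hx)
      ((((S k).continuous.tendsto y).comp hy).congr fun n => ?_)
    have : ((p n).2, S k (p n).2) ∈ (op Φ (MeasFun.cutoff f k)).graph := by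
      rw [hS, ContinuousLinearMap.mem_graph_toTotalPMap]
    rw [mem_graph_op_vec (hp n), hT, ContinuousLinearMap.mem_graph_toTotalPMap] at this
    exact this.symm
  choose h1 h2 using fun k => vec_eq_of_op_eq (hT k) x
  have hlim : ∀ t, Tendsto (fun k => (MeasFun.cutoff f k * f).1 t) atTop (𝓝 (f.1 t)) := fun t => by
    simpa using (MeasFun.tendsto_cutoff f t).mul_const (f.1 t)
  have hfx : MemLp f.1 2 (specMeasure Φ x) := by
    refine ⟨f.2.aestronglyMeasurable, lt_of_le_of_lt
      (Lp.eLpNorm_lim_le_liminf_eLpNorm (fun k => (h1 k).1) f.1 (.of_forall hlim)) ?_⟩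
    -- The norms are those of `S k y`, and each `S k` is a contraction, so `‖y‖` bounds them all.
    refine lt_of_le_of_lt (liminf_le_of_le (by isBoundedDefault) (a := ‖y‖ₑ) fun b hb => ?_)
      enorm_lt_top
    obtain ⟨k, hk⟩ := hb.exists
    refine hk.trans ?_
    rw [← enorm_vec (h1 k), h2, hTS, enorm_le_iff_norm_le]
    simpa using hS1 k y
  refine mem_graph_op.mpr ⟨hfx, ?_⟩
  refine tendsto_nhds_unique (tendsto_vec hfx h1 (tendsto_eLpNorm_of_dominated
    (fun k => (MeasFun.cutoff f k * f).2) f.2 hfx.norm (MeasFun.norm_cutoff_mul_le_norm f) hlim)) ?_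
  simp only [h2, hTS]
  obtain ⟨S₀, hS₀, -⟩ := exists_op_eq Φ (f := 1) (C := 1) (fun t => by simp)
  have hS₀y : S₀ y = y := by
    obtain ⟨h3, h4⟩ := vec_eq_of_op_eq hS₀ y
    rw [← h4]
    exact (vec_continuous (g := 1) h3).trans (by simp)
  have := tendsto_of_op_eq (f := 1) (MeasFun.norm_cutoff_le f) (MeasFun.tendsto_cutoff f) hS hS₀ y
  rwa [hS₀y] at this

theorem op_ofContinuous (g : C(X, 𝕜)) :
    op Φ (MeasFun.ofContinuous g) = (Φ g).toTotalPMap := by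
  refine LinearPMap.ext_graph fun x y => ?_
  rw [mem_graph_op, ContinuousLinearMap.mem_graph_toTotalPMap]
  exact ⟨fun ⟨h, hy⟩ => hy ▸ (vec_continuous h).symm,
    fun h => ⟨memLp_continuous Φ x g, (vec_continuous (memLp_continuous Φ x g)).trans h⟩⟩

variable (Φ) in
/-- The measurable calculus given by the spectral measures of `Φ`. -/
def calculus : MeasurableCalculus 𝕜 X H where
  op := op Φ
  isClosed_op := isClosed_op
  op_one := by
    have := op_ofContinuous (Φ := Φ) 1
    rw [map_one] at this
    exact this
  op_add_le f g := LinearPMap.le_of_graph fun x z hz => by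
    obtain ⟨a, b, ha, hb, rfl⟩ := LinearPMap.mem_graph_add.mp hz
    obtain ⟨h1, rfl⟩ := mem_graph_op.mp ha
    obtain ⟨h2, rfl⟩ := mem_graph_op.mp hb
    exact mem_graph_op.mpr ⟨h1.add h2, vec_add h1 h2⟩
  op_smul_le c f := LinearPMap.le_of_graph fun x z hz => by
    obtain ⟨a, ha, rfl⟩ := LinearPMap.mem_graph_smul.mp hz
    obtain ⟨h1, rfl⟩ := mem_graph_op.mp ha
    exact mem_graph_op.mpr ⟨h1.const_smul c, vec_const_smul h1 c⟩
  op_mul_le f g := LinearPMap.le_of_graph fun x z hz => by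
    obtain ⟨y, hy, hz⟩ := LinearPMap.mem_graph_prodOp.mp hz
    exact (mem_graph_op_vec hy).mp hz
  domain_op_mul f g := by
    ext x
    rw [Submodule.mem_inf, LinearPMap.mem_domain_iff, LinearPMap.mem_domain_iff,
      LinearPMap.mem_domain_iff]
    constructor
    · rintro ⟨z, hz⟩
      obtain ⟨y, hy, hz⟩ := LinearPMap.mem_graph_prodOp.mp hz
      exact ⟨⟨y, hy⟩, z, (mem_graph_op_vec hy).mp hz⟩
    · rintro ⟨⟨y, hy⟩, z, hz⟩
      exact ⟨z, LinearPMap.mem_graph_prodOp.mpr ⟨y, hy, (mem_graph_op_vec hy).mpr hz⟩⟩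
  op_bounded f := by
    rintro ⟨C, hC⟩
    have hC' : ∀ t, ‖f.1 t‖ ≤ C.toNNReal := fun t => (hC t).trans (Real.le_coe_toNNReal C)
    obtain ⟨T, hT, -⟩ := exists_op_eq Φ hC'
    obtain ⟨S, hS, -⟩ := exists_op_eq Φ (f := star f) (C := C.toNNReal)
      (fun t => by simpa using hC' t)
    refine ⟨T, hT, ?_⟩
    rw [hS]
    congr 1
    rw [ContinuousLinearMap.eq_adjoint_iff]
    intro y x
    obtain ⟨h1, h2⟩ := vec_eq_of_op_eq hT x
    obtain ⟨h3, h4⟩ := vec_eq_of_op_eq hS y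
    rw [← h2, ← h4]
    exact (inner_vec_star h1 (vec_eq_of_op_eq hT y).1 h3).symm
  op_tendsto F f := by
    rintro ⟨C, hC⟩ hlim T T₀ hT hT₀ x y
    exact tendsto_const_nhds.inner (tendsto_of_op_eq hC hlim hT hT₀ x)

theorem calculus_extends : (calculus Φ).Extends Φ := op_ofContinuous

end SpectralCalculus

/-! ### Uniqueness: reduction to indicators of a generating π-system -/

namespace MeasurableCalculus

variable {𝕜 : Type*} [RCLike 𝕜] {X : Type*} [MeasurableSpace X]
  {H : Type*} [NormedAddCommGroup H] [InnerProductSpace 𝕜 H] [CompleteSpace H]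

theorem ext_op {Ψ Ψ' : MeasurableCalculus 𝕜 X H} (h : ∀ f, Ψ.op f = Ψ'.op f) : Ψ = Ψ' := by
  cases Ψ; cases Ψ'
  congr
  exact funext h

theorem mem_graph_op_mul (Ψ : MeasurableCalculus 𝕜 X H) {f g : MeasFun 𝕜 X} {x y z : H}
    (hxy : (x, y) ∈ (Ψ.op g).graph) (hyz : (y, z) ∈ (Ψ.op f).graph) :
    (x, z) ∈ (Ψ.op (f * g)).graph :=
  LinearPMap.le_graph_of_le (Ψ.op_mul_le f g) (LinearPMap.mem_graph_prodOp.mpr ⟨y, hxy, hyz⟩)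

omit [CompleteSpace H] in
-- An everywhere defined operator has no proper extension; this turns the inclusions of (MFC2) into
-- equalities for bounded functions.
theorem _root_.ContinuousLinearMap.eq_toTotalPMap_of_le {T : H →L[𝕜] H} {A : H →ₗ.[𝕜] H}
    (h : T.toTotalPMap ≤ A) : A = T.toTotalPMap :=
  (LinearPMap.eq_of_le_of_domain_eq h (top_le_iff.mp h.1).symm).symm

/-- (MFC5) gives only weak convergence. But each `P n` is an orthogonal projection, so `‖P n x - x‖²
= ⟨x, x⟩ - ⟨x, P n x⟩`, and convergence is strong. -/
theorem tendsto_op_cutoff (Ψ : MeasurableCalculus 𝕜 X H) (f : MeasFun 𝕜 X) {P : ℕ → H →L[𝕜] H}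
    (hP : ∀ n, Ψ.op (MeasFun.cutoff f n) = (P n).toTotalPMap) (x : H) :
    Tendsto (fun n => P n x) atTop (𝓝 x) := by
  have hw := Ψ.op_tendsto (MeasFun.cutoff f) 1 ⟨1, (MeasFun.norm_cutoff_le f)⟩ (MeasFun.tendsto_cutoff f) P
    (ContinuousLinearMap.id 𝕜 H) hP Ψ.op_one x x
  have hidem : ∀ n, P n (P n x) = P n x := fun n => by
    have hm : ∀ y, (y, P n y) ∈ (Ψ.op (MeasFun.cutoff f n)).graph := fun y => by
      rw [hP, ContinuousLinearMap.mem_graph_toTotalPMap]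
    have h1 := Ψ.mem_graph_op_mul (hm x) (hm (P n x))
    have h2 : MeasFun.cutoff f n * MeasFun.cutoff f n = MeasFun.cutoff f n := by
      ext t
      by_cases h : ‖f.1 t‖ ≤ n <;> simp [MeasFun.cutoff, MeasFun.indicator, h]
    rw [h2, hP, ContinuousLinearMap.mem_graph_toTotalPMap] at h1
    exact h1.symm
  have hadj : ∀ n, ContinuousLinearMap.adjoint (P n) = P n := fun n => by
    obtain ⟨T, hT, hT'⟩ := Ψ.op_bounded (MeasFun.cutoff f n) ⟨1, MeasFun.norm_cutoff_le f n⟩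
    have h2 : star (MeasFun.cutoff f n) = MeasFun.cutoff f n := by
      ext t
      by_cases h : ‖f.1 t‖ ≤ n <;> simp [MeasFun.cutoff, MeasFun.indicator, h]
    obtain rfl : P n = T := ContinuousLinearMap.toTotalPMap_injective ((hP n).symm.trans hT)
    rw [h2] at hT'
    exact ContinuousLinearMap.toTotalPMap_injective (hT'.symm.trans hT)
  have hnorm : ∀ n, ‖P n x - x‖ ^ 2 = RCLike.re (inner 𝕜 x x) - RCLike.re (inner 𝕜 x (P n x)) := by
    intro n
    have h1 : inner 𝕜 (P n x) (P n x) = inner 𝕜 x (P n x) := by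
      nth_rw 1 [← hadj n]
      rw [ContinuousLinearMap.adjoint_inner_left, hidem]
    rw [← inner_self_eq_norm_sq (𝕜 := 𝕜), inner_sub_left, inner_sub_right, inner_sub_right, h1,
      map_sub, map_sub, map_sub, inner_re_symm (P n x) x]
    ring
  rw [tendsto_iff_norm_sub_tendsto_zero]
  have h2 : Tendsto (fun n => ‖P n x - x‖ ^ 2) atTop (𝓝 0) := by
    have := ((RCLike.continuous_re.tendsto _).comp hw).const_sub (RCLike.re (inner 𝕜 x x))
    simp only [ContinuousLinearMap.id_apply, sub_self] at this
    exact this.congr fun n => (hnorm n).symm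
  have h3 := (Real.continuous_sqrt.tendsto _).comp h2
  simpa [Function.comp_def, Real.sqrt_sq (norm_nonneg _)] using h3

/-- The pairs `(P n x, P n y)` lie in the graph of `Ψ'.op f` because only bounded functions are
involved; they converge to `(x, y)`, and that graph is closed. -/
theorem graph_op_subset_of_bounded {Ψ Ψ' : MeasurableCalculus 𝕜 X H}
    (h : ∀ f : MeasFun 𝕜 X, (∃ C : ℝ, ∀ t, ‖f.1 t‖ ≤ C) → Ψ.op f = Ψ'.op f) (f : MeasFun 𝕜 X)
    (x y : H) (hxy : (x, y) ∈ (Ψ.op f).graph) : (x, y) ∈ (Ψ'.op f).graph := by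
  choose P hP using fun n => (Ψ.op_bounded (MeasFun.cutoff f n) ⟨1, MeasFun.norm_cutoff_le f n⟩).imp fun _ h => h.1
  choose F hF using fun n =>
    (Ψ.op_bounded (MeasFun.cutoff f n * f) ⟨n, MeasFun.norm_cutoff_mul_le f n⟩).imp fun _ h => h.1
  have hP' : ∀ n, Ψ'.op (MeasFun.cutoff f n) = (P n).toTotalPMap := fun n => by
    rw [← h _ ⟨1, MeasFun.norm_cutoff_le f n⟩, hP]
  have hF' : ∀ n, Ψ'.op (f * MeasFun.cutoff f n) = (F n).toTotalPMap := fun n => by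
    rw [mul_comm, ← h _ ⟨n, MeasFun.norm_cutoff_mul_le f n⟩, hF]
  have hlim := (Ψ.tendsto_op_cutoff f hP x).prodMk_nhds (Ψ.tendsto_op_cutoff f hP y)
  refine IsClosed.mem_of_tendsto (Ψ'.isClosed_op f) hlim (.of_forall fun n => ?_)
  have h1 : F n x = P n y := by
    have := Ψ.mem_graph_op_mul (f := MeasFun.cutoff f n) (z := P n y) hxy
      (by rw [hP, ContinuousLinearMap.mem_graph_toTotalPMap])
    rwa [hF, ContinuousLinearMap.mem_graph_toTotalPMap] at this
  -- The domain formula of (MFC3) is essential here: both factors on the right are everywhere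
  -- defined, so `P n x` lies in the domain of `Ψ'.op f`.
  have h2 : x ∈ ((Ψ'.op f).prodOp (Ψ'.op (MeasFun.cutoff f n))).domain := by
    rw [Ψ'.domain_op_mul, hP', hF']
    exact ⟨trivial, trivial⟩
  obtain ⟨z, hz⟩ := LinearPMap.mem_domain_iff.mp h2
  have h3 := LinearPMap.le_graph_of_le (Ψ'.op_mul_le f (MeasFun.cutoff f n)) hz
  obtain ⟨w, hw, hwz⟩ := LinearPMap.mem_graph_prodOp.mp hz
  rw [hF', ContinuousLinearMap.mem_graph_toTotalPMap] at h3
  rw [hP', ContinuousLinearMap.mem_graph_toTotalPMap] at hw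
  rw [← h1, h3]
  rw [hw]
  exact hwz

theorem ext_of_bounded {Ψ Ψ' : MeasurableCalculus 𝕜 X H}
    (h : ∀ f : MeasFun 𝕜 X, (∃ C : ℝ, ∀ t, ‖f.1 t‖ ≤ C) → Ψ.op f = Ψ'.op f) : Ψ = Ψ' :=
  ext_op fun f => LinearPMap.ext_graph fun x y =>
    ⟨graph_op_subset_of_bounded h f x y,
      graph_op_subset_of_bounded (fun f hf => (h f hf).symm) f x y⟩

/-- The two calculi take the same everywhere defined bounded value at `f`. -/
def Agree (Ψ Ψ' : MeasurableCalculus 𝕜 X H) (f : MeasFun 𝕜 X) : Prop :=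
  ∃ T : H →L[𝕜] H, Ψ.op f = T.toTotalPMap ∧ Ψ'.op f = T.toTotalPMap

variable {Ψ Ψ' : MeasurableCalculus 𝕜 X H}

theorem op_add_eq (Ψ : MeasurableCalculus 𝕜 X H) {f g : MeasFun 𝕜 X} {S T : H →L[𝕜] H}
    (hf : Ψ.op f = S.toTotalPMap) (hg : Ψ.op g = T.toTotalPMap) :
    Ψ.op (f + g) = (S + T).toTotalPMap := by
  refine ContinuousLinearMap.eq_toTotalPMap_of_le (le_trans ?_ (Ψ.op_add_le f g))
  refine LinearPMap.le_of_graph fun x y h => LinearPMap.mem_graph_add.mpr ⟨S x, T x, ?_, ?_, ?_⟩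
  · rw [hf, ContinuousLinearMap.mem_graph_toTotalPMap]
  · rw [hg, ContinuousLinearMap.mem_graph_toTotalPMap]
  · exact ContinuousLinearMap.mem_graph_toTotalPMap.mp h

theorem op_smul_eq (Ψ : MeasurableCalculus 𝕜 X H) (c : 𝕜) {f : MeasFun 𝕜 X} {T : H →L[𝕜] H}
    (hf : Ψ.op f = T.toTotalPMap) : Ψ.op (c • f) = (c • T).toTotalPMap := by
  refine ContinuousLinearMap.eq_toTotalPMap_of_le (le_trans ?_ (Ψ.op_smul_le c f))
  refine LinearPMap.le_of_graph fun x y h => LinearPMap.mem_graph_smul.mpr ⟨T x, ?_, ?_⟩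
  · rw [hf, ContinuousLinearMap.mem_graph_toTotalPMap]
  · exact ContinuousLinearMap.mem_graph_toTotalPMap.mp h

namespace Agree

theorem one : Agree Ψ Ψ' 1 := ⟨_, Ψ.op_one, Ψ'.op_one⟩

theorem add {f g : MeasFun 𝕜 X} : Agree Ψ Ψ' f → Agree Ψ Ψ' g → Agree Ψ Ψ' (f + g) :=
  fun ⟨_, hS, hS'⟩ ⟨_, hT, hT'⟩ => ⟨_, Ψ.op_add_eq hS hT, Ψ'.op_add_eq hS' hT'⟩

theorem smul (c : 𝕜) {f : MeasFun 𝕜 X} : Agree Ψ Ψ' f → Agree Ψ Ψ' (c • f) :=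
  fun ⟨_, hT, hT'⟩ => ⟨_, Ψ.op_smul_eq c hT, Ψ'.op_smul_eq c hT'⟩

theorem zero : Agree Ψ Ψ' 0 := by
  simpa using (one (Ψ := Ψ) (Ψ' := Ψ')).smul 0

theorem sum {ι : Type*} (s : Finset ι) {f : ι → MeasFun 𝕜 X} (h : ∀ i, Agree Ψ Ψ' (f i)) :
    Agree Ψ Ψ' (∑ i ∈ s, f i) := by
  classical
  induction s using Finset.induction with
  | empty => simpa using zero
  | insert i s hi ih => rw [Finset.sum_insert hi]; exact (h i).add ih

theorem of_tendsto {F : ℕ → MeasFun 𝕜 X} {f : MeasFun 𝕜 X} {C : ℝ} (hC : ∀ n t, ‖(F n).1 t‖ ≤ C)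
    (hlim : ∀ t, Tendsto (fun n => (F n).1 t) atTop (𝓝 (f.1 t))) (h : ∀ n, Agree Ψ Ψ' (F n)) :
    Agree Ψ Ψ' f := by
  have hf : ∃ C : ℝ, ∀ t, ‖f.1 t‖ ≤ C :=
    ⟨C, fun t => le_of_tendsto (hlim t).norm (.of_forall fun n => hC n t)⟩
  choose T hT hT' using h
  obtain ⟨S, hS, -⟩ := Ψ.op_bounded f hf
  obtain ⟨S', hS', -⟩ := Ψ'.op_bounded f hf
  obtain rfl : S = S' := by
    ext x
    exact ext_inner_left 𝕜 fun y => tendsto_nhds_unique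
      (Ψ.op_tendsto F f ⟨C, hC⟩ hlim T S hT hS x y)
      (Ψ'.op_tendsto F f ⟨C, hC⟩ hlim T S' hT' hS' x y)
  exact ⟨S, hS, hS'⟩

/-- Calculi that agree on the indicators of a generating `π`-system agree on all indicators. -/
theorem indicator_of_generate {s : Set (Set X)} (hgen : ‹MeasurableSpace X› = .generateFrom s)
    (hpi : IsPiSystem s) (hs : ∀ A ∈ s, ∀ hA : MeasurableSet A, Agree Ψ Ψ' (MeasFun.indicator 𝕜 A hA))
    (A : Set X) (hA : MeasurableSet A) : Agree Ψ Ψ' (MeasFun.indicator 𝕜 A hA) := by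
  induction A, hA using MeasurableSpace.induction_on_inter hgen hpi with
  | empty =>
    have : MeasFun.indicator 𝕜 (∅ : Set X) .empty = 0 := by
      ext t; simp [MeasFun.indicator]
    rw [this]; exact zero
  | basic A hA => exact hs A hA _
  | compl A hA ih =>
    have : MeasFun.indicator 𝕜 Aᶜ hA.compl = 1 + (-1 : 𝕜) • MeasFun.indicator 𝕜 A hA := by
      ext t; by_cases h : t ∈ A <;> simp [MeasFun.indicator, h]
    rw [this]
    exact one.add (ih.smul _)
  | iUnion A hd hA ih =>
    -- Disjointness makes the partial sums indicators again, which supplies the uniform bound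
    -- required by (MFC5).
    have hsum : ∀ n t, (∑ i ∈ Finset.range n, MeasFun.indicator 𝕜 (A i) (hA i)).1 t =
        (⋃ i ∈ Finset.range n, A i).indicator 1 t := fun n t => by
      rw [Finset.indicator_biUnion_apply _ _ (fun i _ j _ hij => hd hij)]
      simp [MeasFun.indicator]
    refine of_tendsto (C := 1) (F := fun n => ∑ i ∈ Finset.range n, MeasFun.indicator 𝕜 (A i) (hA i))
      (fun n t => ?_) (fun t => ?_) fun n => sum _ ih
    · rw [hsum]
      by_cases h : t ∈ ⋃ i ∈ Finset.range n, A i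
      · rw [Set.indicator_of_mem h]; simp
      · rw [Set.indicator_of_notMem h]; simp
    · simp only [hsum]
      exact ((tendsto_indicator_biUnion_finset A (1 : X → 𝕜) t).comp
        tendsto_finset_range).mono_right (pure_le_nhds _)

theorem of_indicator (h : ∀ (A : Set X) (hA : MeasurableSet A), Agree Ψ Ψ' (MeasFun.indicator 𝕜 A hA))
    (f : MeasFun 𝕜 X) (hf : ∃ C : ℝ, ∀ t, ‖f.1 t‖ ≤ C) : Agree Ψ Ψ' f := by
  have hsimple : ∀ s : SimpleFunc X 𝕜, Agree Ψ Ψ' ⟨s, s.measurable⟩ := fun s => by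
    induction s using SimpleFunc.induction with
    | const c hA =>
      convert (h _ hA).smul c using 1
      ext t
      classical
      simp [MeasFun.indicator, Set.indicator_apply, Set.piecewise]
    | add _ h1 h2 =>
      exact h1.add h2
  obtain ⟨C, hC⟩ := hf
  have hm : StronglyMeasurable f.1 := Measurable.stronglyMeasurable f.2
  have hC' : ∀ t, ‖f.1 t‖ ≤ max C 0 := fun t => (hC t).trans (le_max_left _ _)
  -- The level is `max C 0` because the bound for `approxBounded` needs a nonnegative constant, and
  -- `C` may be negative when `X` is empty.
  exact of_tendsto (F := fun n => ⟨hm.approxBounded (max C 0) n, (SimpleFunc.measurable _)⟩)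
    (hm.norm_approxBounded_le (le_max_right _ _))
    (fun t => hm.tendsto_approxBounded_of_norm_le (hC' t)) fun n => hsimple _

end Agree

theorem ext_of_generate {s : Set (Set X)} (hgen : ‹MeasurableSpace X› = .generateFrom s)
    (hpi : IsPiSystem s)
    (hs : ∀ A ∈ s, ∀ hA : MeasurableSet A, Agree Ψ Ψ' (MeasFun.indicator 𝕜 A hA)) : Ψ = Ψ' :=
  ext_of_bounded fun f hf => by
    obtain ⟨T, h, h'⟩ := Agree.of_indicator (Agree.indicator_of_generate hgen hpi hs) f hf
    rw [h, h']

/-! ### Uniqueness in the metrizable and in the regular case -/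

section Borel

variable [TopologicalSpace X] [BorelSpace X]

theorem Extends.agree {Φ : C(X, 𝕜) → (H →L[𝕜] H)} (h : Ψ.Extends Φ) (h' : Ψ'.Extends Φ)
    (f : C(X, 𝕜)) : Agree Ψ Ψ' (MeasFun.ofContinuous f) := ⟨Φ f, h f, h' f⟩

theorem eq_of_extends_of_hasOuterApproxClosed [HasOuterApproxClosed X]
    {Φ : C(X, 𝕜) → (H →L[𝕜] H)} (h : Ψ.Extends Φ) (h' : Ψ'.Extends Φ) : Ψ = Ψ' := by
  refine ext_of_generate (BorelSpace.measurable_eq.trans borel_eq_generateFrom_isClosed)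
    isPiSystem_isClosed fun F hF hA => ?_
  refine Agree.of_tendsto (C := 1) (F := fun n => MeasFun.ofContinuous
    ⟨fun t => ((hF.apprSeq n t : ℝ) : 𝕜), by fun_prop⟩) (fun n t => ?_) (fun t => ?_)
    fun n => h.agree h' _
  · simpa [MeasFun.ofContinuous] using HasOuterApproxClosed.apprSeq_apply_le_one hF n t
  · have h1 := tendsto_pi_nhds.mp (HasOuterApproxClosed.tendsto_apprSeq hF) t
    have h2 : Continuous fun r : ℝ≥0 => ((r : ℝ) : 𝕜) := by fun_prop
    have h3 : (MeasFun.indicator 𝕜 F hA).1 t = (((F.indicator (fun _ => (1 : ℝ≥0)) t : ℝ≥0) : ℝ) : 𝕜) := by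
      by_cases ht : t ∈ F <;> simp [MeasFun.indicator, ht]
    rw [h3]
    exact (h2.tendsto _).comp h1

omit [TopologicalSpace X] [BorelSpace X] in
theorem isSelfAdjoint_of_op_ofRealFun (Ψ : MeasurableCalculus 𝕜 X H) {f : X → ℝ}
    (hf : Measurable f) {C : ℝ} (hC : ∀ t, |f t| ≤ C) {T : H →L[𝕜] H}
    (hT : Ψ.op (MeasFun.ofRealFun 𝕜 f hf) = T.toTotalPMap) : IsSelfAdjoint T := by
  obtain ⟨S, hS, hS'⟩ := Ψ.op_bounded (MeasFun.ofRealFun 𝕜 f hf)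
    ⟨C, fun t => by simpa [MeasFun.ofRealFun] using hC t⟩
  obtain rfl : T = S := ContinuousLinearMap.toTotalPMap_injective (hT.symm.trans hS)
  have : star (MeasFun.ofRealFun 𝕜 f hf) = MeasFun.ofRealFun 𝕜 f hf := by
    ext t; simp [MeasFun.ofRealFun]
  rw [this] at hS'
  exact ContinuousLinearMap.toTotalPMap_injective (hS'.symm.trans hT)

/-- Indicators of open sets are lower semicontinuous, and the supremum for them involves only
continuous functions, where the calculi agree. Hence the quadratic forms coincide. -/
theorem eq_of_extends_of_isRegular {Φ : C(X, 𝕜) → (H →L[𝕜] H)} (h : Ψ.Extends Φ)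
    (h' : Ψ'.Extends Φ) (hr : Ψ.IsRegular) (hr' : Ψ'.IsRegular) : Ψ = Ψ' := by
  refine ext_of_generate (BorelSpace.measurable_eq) isPiSystem_isOpen fun U hU hA => ?_
  have hlsc : LowerSemicontinuous (U.indicator fun _ => (1 : ℝ)) :=
    IsOpen.lowerSemicontinuous_indicator hU zero_le_one
  have h0 : ∀ t, 0 ≤ U.indicator (fun _ => (1 : ℝ)) t :=
    fun t => Set.indicator_nonneg (fun _ _ => zero_le_one) t
  have h1 : ∀ t, U.indicator (fun _ => (1 : ℝ)) t ≤ 1 :=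
    fun t => Set.indicator_le_self' (fun _ _ => zero_le_one) t
  have habs : ∀ t, |U.indicator (fun _ => (1 : ℝ)) t| ≤ 1 := fun t => by
    rw [abs_of_nonneg (h0 t)]; exact h1 t
  have heq : MeasFun.indicator 𝕜 U hA = MeasFun.ofRealFun 𝕜 _ hlsc.measurable := by
    ext t; by_cases ht : t ∈ U <;> simp [MeasFun.indicator, MeasFun.ofRealFun, ht]
  have hbd : ∃ C : ℝ, ∀ t, ‖(MeasFun.ofRealFun 𝕜 _ hlsc.measurable).1 t‖ ≤ C :=
    ⟨1, fun t => by simpa [MeasFun.ofRealFun] using habs t⟩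
  rw [heq]
  obtain ⟨T, hT, -⟩ := Ψ.op_bounded _ hbd
  obtain ⟨T', hT', -⟩ := Ψ'.op_bounded _ hbd
  refine ⟨T, hT, ?_⟩
  suffices T - T' = 0 by rw [hT', sub_eq_zero.mp this]
  -- Over `ℝ` a vanishing quadratic form does not force an operator to vanish; symmetry is what
  -- permits the conclusion for both scalar fields.
  have hsa : IsSelfAdjoint (T - T') :=
    (Ψ.isSelfAdjoint_of_op_ofRealFun hlsc.measurable habs hT).sub
      (Ψ'.isSelfAdjoint_of_op_ofRealFun hlsc.measurable habs hT')
  have hz := hsa.isSymmetric.inner_map_self_eq_zero.mp fun x => by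
    obtain ⟨s, hs, hlub⟩ := hr _ hlsc h0 ⟨1, h1⟩ T hT x
    obtain ⟨s', hs', hlub'⟩ := hr' _ hlsc h0 ⟨1, h1⟩ T' hT' x
    have hcont : ∀ g : C(X, ℝ), Ψ.op (MeasFun.ofRealFun 𝕜 g g.continuous.measurable) =
        Ψ'.op (MeasFun.ofRealFun 𝕜 g g.continuous.measurable) := fun g => by
      obtain ⟨S, h1, h2⟩ := h.agree h' (SpectralCalculus.ofRealMap 𝕜 g)
      exact h1.trans h2.symm
    simp only [hcont] at hlub
    have hss : s = s' := hlub.unique hlub'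
    rw [ContinuousLinearMap.coe_coe, ← inner_conj_symm, sub_apply, inner_sub_right, hs, hs', hss]
    simp
  exact ContinuousLinearMap.coe_injective hz

end Borel

end MeasurableCalculus

/-! ### Regularity of the constructed calculus -/

namespace SpectralCalculus

/-- The bound `N * δ` is carried along for the induction: it controls the step at which the next
threshold is passed. Strict thresholds make the superlevel sets open in the application. -/
theorem sum_step_le {a δ : ℝ} (ha : 0 ≤ a) (hδ : 0 ≤ δ) (N : ℕ) :
    ∑ k ∈ Finset.range N, (if (k + 1) * δ < a then δ else 0) ≤ min a (N * δ) := by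
  induction N with
  | zero => simp [ha]
  | succ N ih =>
    rw [Finset.sum_range_succ]
    push_cast
    obtain ⟨h1, h2⟩ := le_min_iff.mp ih
    split_ifs with h
    · exact le_min (by linarith) (by linarith)
    · exact le_min (by linarith) (by linarith)

/-- For `δ > 0`, a value in `(N * δ, (N + 1) * δ]` passes all `N` thresholds, and the staircase
falls short by at most `δ`; hence `N + 1`. -/
theorem min_le_sum_step (a δ : ℝ) (N : ℕ) :
    min a ((N + 1) * δ) ≤ ∑ k ∈ Finset.range N, (if (k + 1) * δ < a then δ else 0) + δ := by
  induction N with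
  | zero => simp
  | succ N ih =>
    rw [Finset.sum_range_succ]
    push_cast
    split_ifs with h
    · rw [min_eq_right h.le] at ih
      exact (min_le_right _ _).trans (by linarith)
    · rw [min_eq_left (not_lt.mp h)] at ih
      exact (min_le_left _ _).trans (by linarith)

section Measure

variable {X : Type*} [TopologicalSpace X] [CompactSpace X] [T2Space X] [MeasurableSpace X]
  [BorelSpace X]

/-- Inner regularity gives a compact `K ⊆ U` of nearly full measure; Urysohn separates it from the
complement of `U`. -/
theorem exists_continuous_le_indicator (μ : Measure X) [IsFiniteMeasure μ] [μ.Regular] {U : Set X}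
    (hU : IsOpen U) {η : ℝ} (hη : 0 < η) :
    ∃ u : C(X, ℝ), (∀ t, 0 ≤ u t) ∧ (∀ t, u t ≤ U.indicator 1 t) ∧
      ∫ t, U.indicator 1 t ∂μ ≤ ∫ t, u t ∂μ + η := by
  obtain ⟨K, hKU, hK, hμK⟩ := hU.measurableSet.exists_isCompact_lt_add (measure_ne_top μ U)
    (ε := ENNReal.ofReal η) (by simpa using hη)
  obtain ⟨u, hu0, hu1, hu⟩ := exists_continuous_zero_one_of_isClosed hU.isClosed_compl hK.isClosed
    (Set.disjoint_compl_left_iff_subset.mpr hKU)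
  refine ⟨u, fun t => (hu t).1, fun t => ?_, ?_⟩
  · by_cases ht : t ∈ U
    · simpa [ht] using (hu t).2
    · simpa [ht] using (hu0 ht).le
  · rw [integral_indicator_one hU.measurableSet]
    have h1 : μ.real U ≤ μ.real K + η := by
      have := ENNReal.toReal_mono (by finiteness) hμK.le
      rwa [ENNReal.toReal_add (by finiteness) (by finiteness), ENNReal.toReal_ofReal hη.le] at this
    have h2 : μ.real K ≤ ∫ t, u t ∂μ := by
      rw [← integral_indicator_one hK.measurableSet]
      refine integral_mono ((integrable_const (1 : ℝ)).indicator hK.measurableSet)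
        (u.continuous.integrable_of_hasCompactSupport (HasCompactSupport.of_compactSpace _))
        fun t => ?_
      by_cases ht : t ∈ K
      · simpa [ht] using (hu1 ht).ge
      · simpa [ht] using (hu t).1
    linarith

/-- A staircase of height `δ` on open superlevel sets approximates `f` from below, and each step is
replaced by a continuous function below it. The staircase and the replacements each cost at most `ε
/ 2`. -/
theorem exists_continuous_le_of_lowerSemicontinuous (μ : Measure X) [IsFiniteMeasure μ]
    [μ.Regular] {f : X → ℝ} (hf : LowerSemicontinuous f) (h0 : ∀ t, 0 ≤ f t) {C : ℝ}
    (hC : ∀ t, f t ≤ C) {ε : ℝ} (hε : 0 < ε) :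
    ∃ g : C(X, ℝ), (∀ t, 0 ≤ g t) ∧ (∀ t, g t ≤ f t) ∧ ∫ t, f t ∂μ ≤ ∫ t, g t ∂μ + ε := by
  obtain ⟨δ, hδ, hδμ⟩ : ∃ δ : ℝ, 0 < δ ∧ δ * μ.real Set.univ ≤ ε / 2 := by
    -- The `+ 1` keeps the denominator positive when `μ = 0`; below, it does so when `N = 0`.
    refine ⟨ε / 2 / (μ.real Set.univ + 1), by positivity, ?_⟩
    rw [div_mul_eq_mul_div, div_le_iff₀ (by positivity)]
    nlinarith
  obtain ⟨N, hN⟩ := exists_nat_ge (C / δ)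
  rw [div_le_iff₀ hδ] at hN
  obtain ⟨η, hη, hηN⟩ : ∃ η : ℝ, 0 < η ∧ N * (δ * η) ≤ ε / 2 := by
    refine ⟨ε / 2 / (N * δ + 1), by positivity, ?_⟩
    rw [← mul_assoc, mul_div_assoc', div_le_iff₀ (by positivity)]
    nlinarith
  have hU : ∀ k : ℕ, IsOpen {t | (k + 1) * δ < f t} := fun k => hf.isOpen_preimage _
  choose u hu0 hu1 hu using fun k : ℕ => exists_continuous_le_indicator μ (hU k) hη
  have hstep : ∀ t, ∑ k ∈ Finset.range N, δ * {t | (k + 1) * δ < f t}.indicator 1 t =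
      ∑ k ∈ Finset.range N, (if (k + 1) * δ < f t then δ else 0) := fun t => by
    simp [Set.indicator_apply]
  have hui : ∀ k, Integrable (u k) μ := fun k =>
    (u k).continuous.integrable_of_hasCompactSupport (HasCompactSupport.of_compactSpace _)
  have hUi : ∀ k : ℕ, Integrable ({t | (k + 1) * δ < f t}.indicator (1 : X → ℝ)) μ := fun k =>
    (integrable_const (1 : ℝ)).indicator (hU k).measurableSet
  refine ⟨∑ k ∈ Finset.range N, δ • u k, fun t => ?_, fun t => ?_, ?_⟩
  · simp only [ContinuousMap.coe_sum, Finset.sum_apply, ContinuousMap.coe_smul, Pi.smul_apply,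
      smul_eq_mul]
    exact Finset.sum_nonneg fun k _ => mul_nonneg hδ.le (hu0 k t)
  · simp only [ContinuousMap.coe_sum, Finset.sum_apply, ContinuousMap.coe_smul, Pi.smul_apply,
      smul_eq_mul]
    refine (Finset.sum_le_sum fun k _ => mul_le_mul_of_nonneg_left (hu1 k t) hδ.le).trans ?_
    rw [hstep]
    exact (sum_step_le (h0 t) hδ.le N).trans (min_le_left _ _)
  · have h1 : ∫ t, f t ∂μ ≤
        ∫ t, (∑ k ∈ Finset.range N, δ * {t | (k + 1) * δ < f t}.indicator 1 t + δ) ∂μ := by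
      refine integral_mono (Integrable.of_bound hf.measurable.aestronglyMeasurable C
        (.of_forall fun t => by rw [Real.norm_of_nonneg (h0 t)]; exact hC t))
        ((integrable_finsetSum _ fun k _ => (hUi k).const_mul δ).add (integrable_const _))
        fun t => ?_
      dsimp only
      rw [hstep]
      refine le_trans (le_min le_rfl ?_) (min_le_sum_step (f t) δ N)
      linarith [hC t]
    have h2 : ∫ t, (∑ k ∈ Finset.range N, δ • u k : C(X, ℝ)) t ∂μ =
        ∑ k ∈ Finset.range N, δ * ∫ t, u k t ∂μ := by
      simp only [ContinuousMap.coe_sum, Finset.sum_apply, ContinuousMap.coe_smul, Pi.smul_apply,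
        smul_eq_mul]
      rw [integral_finsetSum _ fun k _ => (hui k).const_mul δ]
      simp only [integral_const_mul]
    rw [integral_add (integrable_finsetSum _ fun k _ => (hUi k).const_mul δ) (integrable_const _),
      integral_finsetSum _ fun k _ => (hUi k).const_mul δ, integral_const, smul_eq_mul] at h1
    simp only [integral_const_mul] at h1
    have h3 : ∑ k ∈ Finset.range N, δ * ∫ t, {t | (k + 1) * δ < f t}.indicator 1 t ∂μ ≤
        ∑ k ∈ Finset.range N, (δ * ∫ t, u k t ∂μ + δ * η) :=
      Finset.sum_le_sum fun k _ => by
        rw [← mul_add]; exact mul_le_mul_of_nonneg_left (hu k) hδ.le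
    rw [Finset.sum_add_distrib, Finset.sum_const, Finset.card_range, nsmul_eq_mul] at h3
    rw [h2]
    linarith

end Measure

variable {𝕜 : Type*} [RCLike 𝕜]
  {X : Type*} [TopologicalSpace X] [CompactSpace X] [T2Space X] [MeasurableSpace X] [BorelSpace X]
  {H : Type*} [NormedAddCommGroup H] [InnerProductSpace 𝕜 H] [CompleteSpace H]
  {Φ : C(X, 𝕜) →⋆ₐ[𝕜] (H →L[𝕜] H)}

/-- With `R` the self-adjoint operator of `√f`, `T = R²`, so `⟨x, T x⟩ = ‖R x‖²`, which the isometry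
evaluates as `∫ (√f)² dμ_x`. -/
theorem inner_eq_integral {f : X → ℝ} (hf : Measurable f) (h0 : ∀ t, 0 ≤ f t) {C : ℝ}
    (hC : ∀ t, f t ≤ C) {T : H →L[𝕜] H}
    (hT : (calculus Φ).op (MeasFun.ofRealFun 𝕜 f hf) = T.toTotalPMap) (x : H) :
    inner 𝕜 x (T x) = ((∫ t, f t ∂(specMeasure Φ x) : ℝ) : 𝕜) := by
  set r : MeasFun 𝕜 X := MeasFun.ofRealFun 𝕜 (fun t => √(f t)) (by fun_prop) with hr
  have hrr : r * r = MeasFun.ofRealFun 𝕜 f hf := by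
    ext t
    simp [hr, MeasFun.ofRealFun, ← RCLike.ofReal_mul, Real.mul_self_sqrt (h0 t)]
  have hrC : ∀ t, |√(f t)| ≤ √C := fun t => by
    rw [abs_of_nonneg (Real.sqrt_nonneg _)]; exact Real.sqrt_le_sqrt (hC t)
  obtain ⟨R, hR, -⟩ := (calculus Φ).op_bounded r
    ⟨√C, fun t => by simpa [hr, MeasFun.ofRealFun] using hrC t⟩
  have hsa : IsSelfAdjoint R := (calculus Φ).isSelfAdjoint_of_op_ofRealFun _ hrC hR
  have hmem : ∀ y, (y, R y) ∈ ((calculus Φ).op r).graph := fun y => by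
    rw [hR, ContinuousLinearMap.mem_graph_toTotalPMap]
  have hRR := (calculus Φ).mem_graph_op_mul (hmem x) (hmem (R x))
  rw [hrr, hT, ContinuousLinearMap.mem_graph_toTotalPMap] at hRR
  obtain ⟨h1, h2⟩ := vec_eq_of_op_eq hR x
  rw [hRR, ← ContinuousLinearMap.adjoint_inner_left, hsa.adjoint_eq, inner_self_eq_norm_sq_to_K,
    ← RCLike.ofReal_pow]
  congr 1
  rw [← toReal_enorm, ← h2, enorm_vec, ← ENNReal.toReal_pow, eLpNorm_two_sq,
    integral_eq_lintegral_of_nonneg_ae (.of_forall h0) hf.aestronglyMeasurable]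
  congr 1
  refine lintegral_congr fun t => ?_
  rw [← ofReal_norm, ← ENNReal.ofReal_pow (norm_nonneg _)]
  congr 1
  simp [hr, MeasFun.ofRealFun, Real.sq_sqrt (h0 t)]

theorem calculus_isRegular : (calculus Φ).IsRegular := by
  rintro f hf h0 ⟨C, hC⟩ T hT x
  refine ⟨_, inner_eq_integral hf.measurable h0 hC hT x, ?_⟩
  have hfi : Integrable f (specMeasure Φ x) :=
    Integrable.of_bound hf.measurable.aestronglyMeasurable C
      (.of_forall fun t => by rw [Real.norm_of_nonneg (h0 t)]; exact hC t)
  constructor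
  · rintro r ⟨g, -, hg0, hgf, S, hS, hr⟩
    rw [inner_eq_integral g.continuous.measurable hg0 (fun t => (hgf t).trans (hC t)) hS,
      RCLike.ofReal_inj] at hr
    rw [← hr]
    exact integral_mono (g.continuous.integrable_of_hasCompactSupport
      (HasCompactSupport.of_compactSpace _)) hfi hgf
  · intro b hb
    refine le_of_forall_pos_le_add fun ε hε => ?_
    obtain ⟨g, hg0, hgf, hg⟩ :=
      exists_continuous_le_of_lowerSemicontinuous (specMeasure Φ x) hf h0 hC hε
    have hS := calculus_extends (Φ := Φ) (ofRealMap 𝕜 g)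
    refine hg.trans (add_le_add_left (hb ⟨g, HasCompactSupport.of_compactSpace _, hg0, hgf, _, hS,
      inner_eq_integral g.continuous.measurable hg0 (fun t => (hgf t).trans (hC t)) hS x⟩) ε)

end SpectralCalculus

end

theorem mainTheorem7 {𝕜 : Type*} [RCLike 𝕜]
    {X : Type*} [TopologicalSpace X] [CompactSpace X] [T2Space X]
    [MeasurableSpace X] [BorelSpace X]
    {H : Type*} [NormedAddCommGroup H] [InnerProductSpace 𝕜 H] [CompleteSpace H]
    (Φ : C(X, 𝕜) →⋆ₐ[𝕜] (H →L[𝕜] H)) :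
    (∃! Ψ : MeasurableCalculus 𝕜 X H, Ψ.Extends Φ ∧ Ψ.IsRegular) ∧
    (TopologicalSpace.MetrizableSpace X →
      ∃! Ψ : MeasurableCalculus 𝕜 X H, Ψ.Extends Φ) := by
  refine ⟨⟨SpectralCalculus.calculus Φ,
    ⟨SpectralCalculus.calculus_extends, SpectralCalculus.calculus_isRegular⟩, fun Ψ h =>
      MeasurableCalculus.eq_of_extends_of_isRegular h.1 SpectralCalculus.calculus_extends h.2
        SpectralCalculus.calculus_isRegular⟩, fun _ => ?_⟩
  -- A metric supplies the `HasOuterApproxClosed` instance.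
  let _ := TopologicalSpace.metrizableSpaceMetric X
  exact ⟨SpectralCalculus.calculus Φ, SpectralCalculus.calculus_extends, fun Ψ h =>
    MeasurableCalculus.eq_of_extends_of_hasOuterApproxClosed h SpectralCalculus.calculus_extends⟩
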